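/- Let $(A_n,B_n)_{n\ge 1}$ be i.i.d. random vectors in $\mathbb{R}^2$ with generic element $(A,B)$, where $A>0$ a.s., let $X_0$ be a real random variable independent of $(A_n,B_n)_{n\ge1}$, and let $X_n=A_nX_{n-1}+B_n$ for $n\ge1$. Write $g(t)\sim h(t)$ for $\lim_{t\to\infty} g(t)/h(t)=1$, and let $A'$ be an independent copy of $A$. Assume that for some $\alpha>0$: 1. $\mathbb{P}[A>ty]\sim y^{-\alpha}\,\mathbb{P}[A>t]$ for every $y>0$; 2. $\mathbb{P}[AA'>t]\sim 2\,\mathbb{E}[A^\alpha]\,\mathbb{P}[A>t]$ and $\mathbb{E}[A^\alpha]<1$; 3. $\limsup_{t\to\infty}\mathbb{P}[|B|>t]/\mathbb{P}[A>t]<\infty$. Let $X=\sum_{k=0}^{\infty}B_{k+1}\prod_{j=1}^{k}A_j$ (under 1--3 this series converges a.s.), and assume moreover that there are measurable functions $f_+,f_-:\mathbb{R}\to[0,\infty)$ such that, for every $y$ in the support of the law of $X$, $$\lim_{t\to\infty}\frac{\mathbb{P}[Ay+B>t]}{\mathbb{P}[A>t]}=f_+(y),\qquad \lim_{t\to\infty}\frac{\mathbb{P}[Ay+B<-t]}{\mathbb{P}[A>t]}=f_-(y).$$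 Then the series defining $X$ converges absolutely a.s., its law satisfies $X\stackrel{d}{=}AX+B$ with $X$ independent of $(A,B)$, the chain $X_n$ converges weakly to $X$, the expectations $\mathbb{E}[f_\pm(X)]$ are finite, and $$\lim_{t\to\infty}\frac{\mathbb{P}[X>t]}{\mathbb{P}[A>t]}=\frac{\mathbb{E}[f_+(X)]}{1-\mathbb{E}[A^\alpha]},\qquad \lim_{t\to\infty}\frac{\mathbb{P}[X<-t]}{\mathbb{P}[A>t]}=\frac{\mathbb{E}[f_-(X)]}{1-\mathbb{E}[A^\alpha]}.$$ -/

import Mathlib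

open MeasureTheory ProbabilityTheory Filter Topology

namespace RandomDifference

/-- `g ∼ h` at `+∞`, that is `g(t) / h(t) → 1` as `t → ∞`. -/
def TailEquiv (g h : ℝ → ℝ) : Prop :=
  Tendsto (fun t => g t / h t) atTop (𝓝 1)

/-- The right tail `t ↦ ℙ[Y > t]` of a real random variable `Y`. -/
noncomputable def tail {Ω : Type*} [MeasurableSpace Ω] (P : Measure Ω) (Y : Ω → ℝ) (t : ℝ) : ℝ :=
  P.real {ω | t < Y ω}

/-- The left tail `t ↦ ℙ[Y < -t]` of a real random variable `Y`. -/
noncomputable def leftTail {Ω : Type*} [MeasurableSpace Ω] (P : Measure Ω) (Y : Ω → ℝ)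
    (t : ℝ) : ℝ :=
  P.real {ω | Y ω < -t}

/-- The chain driven by the random vectors `(A 0, B 0), (A 1, B 1), …` and started at `X₀`:
the pair `(A n, B n)` is the one applied in the step from time `n` to time `n + 1`. -/
def chain {Ω : Type*} (A B : ℕ → Ω → ℝ) (X₀ : Ω → ℝ) : ℕ → Ω → ℝ
  | 0 => X₀
  | n + 1 => fun ω => A n ω * chain A B X₀ n ω + B n ω

/-- The `k`-th term `(∏_{j < k} A j) * B k` of the perpetuity series. -/
def perpetuityTerm {Ω : Type*} (A B : ℕ → Ω → ℝ) (k : ℕ) (ω : Ω) : ℝ :=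
  B k ω * ∏ j ∈ Finset.range k, A j ω

/-- The perpetuity `∑_k (∏_{j < k} A j) * B k`. -/
noncomputable def perpetuity {Ω : Type*} (A B : ℕ → Ω → ℝ) (ω : Ω) : ℝ :=
  ∑' k, perpetuityTerm A B k ω

end RandomDifference

set_option linter.unusedSectionVars false

namespace RandomDifference

variable {Ω : Type*} [MeasurableSpace Ω] {P : Measure Ω}

/-! Write F(t) = ℙ[A > t], ρ = 𝔼[A^α] and ρ_K = 𝔼[A^α; A ≤ K]. The convolution condition is a
single-big-factor principle. Dominated convergence gives ℙ[AA' > s, A ≤ K] ~ ρ_K F(s), and the same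
holds with A' ≤ K. What is left of 2ρ F(s) for both factors above K is 2(ρ - ρ_K) F(s), which is
negligible as K → ∞ (`tendsto_product_of_le`, `tendsto_product_of_gt`). Conditioning on A transfers
these estimates from A' to any independent Y whose tail is compared with F
(`measureReal_product_le`).

Domination: if ℙ[Y > t] ≤ C F(t), then AY + |B| satisfies such a bound for large t with θC + D, θ <
1 (`exists_affine_tail_bound`). Iterating along the partial sums of the absolute series gives one C
for all of them. The series therefore converges absolutely, and |X| has tail at most C F.

Limit: X = AY + B with Y the perpetuity of the shifted sequence, a copy of X independent of (A, B).
The part |Y| ≤ K contributes 𝔼[f(Y); |Y| ≤ K] F(t). For |Y| > K, a large B costs a further factor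
ℙ[|Y| > K], and a large AY contributes about ρ times the tail of Y. Hence asymptotic bounds L and l
for ℙ[Y > t]/F(t) improve to e + ρL and e + ρl with e = 𝔼[f(Y)], which forces the limit e/(1 - ρ)
(`tendsto_of_affine_bounds`). The left tail follows by changing the sign of B.

Weak convergence: X_n has the law of the backward iterate, which converges almost surely to X
because the products of the A_j tend to 0. -/

theorem tail_nonneg (Y : Ω → ℝ) (t : ℝ) : 0 ≤ tail P Y t := measureReal_nonneg

theorem tail_le_one [IsProbabilityMeasure P] (Y : Ω → ℝ) (t : ℝ) : tail P Y t ≤ 1 :=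
  measureReal_le_one

theorem tail_antitone [IsFiniteMeasure P] (Y : Ω → ℝ) : Antitone (tail P Y) := fun _ _ hst =>
  measureReal_mono fun _ hω => lt_of_le_of_lt hst hω

theorem _root_.ProbabilityTheory.IdentDistrib.tail_eq {Y Y' : Ω → ℝ} (h : IdentDistrib Y Y' P P)
    (t : ℝ) : tail P Y t = tail P Y' t := by
  simp only [tail, measureReal_def]
  exact congrArg ENNReal.toReal (h.measure_mem_eq (measurableSet_Ioi (a := t)))

/-! ### Conditioning on an independent factor -/

/-- The probability of a joint event of two independent random variables, computed by
conditioning on the first one. -/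
theorem measureReal_eq_integral_of_indepFun [IsProbabilityMeasure P] {E G : Type*}
    [MeasurableSpace E] [MeasurableSpace G] {U : Ω → E} {V : Ω → G} (hU : Measurable U)
    (hV : Measurable V) (hUV : IndepFun U V P) {S : Set (E × G)} (hS : MeasurableSet S) :
    P.real {ω | (U ω, V ω) ∈ S} = ∫ ω, P.real {ω' | (U ω, V ω') ∈ S} ∂P := by
  have := Measure.isProbabilityMeasure_map (μ := P) hU.aemeasurable
  have := Measure.isProbabilityMeasure_map (μ := P) hV.aemeasurable
  have h1 : P {ω | (U ω, V ω) ∈ S} = ∫⁻ ω, P {ω' | (U ω, V ω') ∈ S} ∂P := by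
    have h2 : P {ω | (U ω, V ω) ∈ S} = P.map (fun ω => (U ω, V ω)) S := by
      rw [Measure.map_apply (hU.prodMk hV) hS]; rfl
    rw [h2, (indepFun_iff_map_prod_eq_prod_map_map hU.aemeasurable hV.aemeasurable).1 hUV,
      Measure.prod_apply hS, lintegral_map (measurable_measure_prodMk_left hS) hU]
    refine lintegral_congr fun ω => ?_
    rw [Measure.map_apply hV (measurable_prodMk_left hS)]
    rfl
  have hmeas : Measurable fun ω => P {ω' | (U ω, V ω') ∈ S} := by
    have : (fun ω => P {ω' | (U ω, V ω') ∈ S}) =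
        (fun x => P.map V (Prod.mk x ⁻¹' S)) ∘ U := by
      ext ω
      simp only [Function.comp]
      rw [Measure.map_apply hV (measurable_prodMk_left hS)]
      rfl
    rw [this]
    exact (measurable_measure_prodMk_left hS).comp hU
  simp only [measureReal_def]
  rw [integral_toReal hmeas.aemeasurable (ae_of_all _ fun ω => measure_lt_top _ _), h1]

theorem measurable_measureReal_section [IsProbabilityMeasure P] {E G : Type*}
    [MeasurableSpace E] [MeasurableSpace G] {V : Ω → G}
    (hV : Measurable V) {S : Set (E × G)} (hS : MeasurableSet S) :
    Measurable fun x => P.real {ω' | (x, V ω') ∈ S} := by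
  have := Measure.isProbabilityMeasure_map (μ := P) hV.aemeasurable
  have : (fun x => P.real {ω' | (x, V ω') ∈ S}) =
      fun x => (P.map V (Prod.mk x ⁻¹' S)).toReal := by
    ext x
    rw [Measure.map_apply hV (measurable_prodMk_left hS)]
    rfl
  rw [this]
  exact (measurable_measure_prodMk_left hS).ennreal_toReal

/-- Tails of products `A * Y` with an independent positive factor `A` are monotone in the tail
of `Y`. -/
theorem measureReal_product_le [IsProbabilityMeasure P] {A Y Y' : Ω → ℝ} (hA : Measurable A)
    (hY : Measurable Y) (hY' : Measurable Y') (hAY : IndepFun A Y P) (hAY' : IndepFun A Y' P)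
    (hpos : ∀ᵐ ω ∂P, 0 < A ω) {c C k : ℝ}
    (h : ∀ t, k ≤ t → c * tail P Y t ≤ C * tail P Y' t) {S : Set ℝ} (hS : MeasurableSet S)
    (s : ℝ) :
    c * P.real {ω | A ω ∈ S ∧ k < Y ω ∧ s < A ω * Y ω} ≤
      C * P.real {ω | A ω ∈ S ∧ k < Y' ω ∧ s < A ω * Y' ω} := by
  have hT : MeasurableSet {p : ℝ × ℝ | p.1 ∈ S ∧ k < p.2 ∧ s < p.1 * p.2} :=
    (measurable_fst hS).inter ((measurableSet_lt measurable_const measurable_snd).inter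
      (measurableSet_lt measurable_const (measurable_fst.mul measurable_snd)))
  have e1 := measureReal_eq_integral_of_indepFun hA hY hAY hT
  have e2 := measureReal_eq_integral_of_indepFun hA hY' hAY' hT
  simp only [Set.mem_ofPred_eq] at e1 e2
  rw [e1, e2, ← integral_const_mul, ← integral_const_mul]
  have hint : ∀ Z : Ω → ℝ, Measurable Z → Integrable
      (fun ω => P.real {ω' | A ω ∈ S ∧ k < Z ω' ∧ s < A ω * Z ω'}) P := fun Z hZ =>
    Integrable.of_bound ((measurable_measureReal_section hZ hT).comp hA).aestronglyMeasurable 1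
      (ae_of_all _ fun ω => by
        rw [Real.norm_of_nonneg measureReal_nonneg]; exact measureReal_le_one)
  refine integral_mono_ae ((hint Y hY).const_mul c) ((hint Y' hY').const_mul C) ?_
  filter_upwards [hpos] with ω hω
  -- With A = a > 0 fixed, the event is a single tail at level max(k, s/a) ≥ k, where the assumed
  -- comparison applies.
  have key : ∀ Z : Ω → ℝ, A ω ∈ S →
      P.real {ω' | A ω ∈ S ∧ k < Z ω' ∧ s < A ω * Z ω'} = tail P Z (max k (s / A ω)) := by
    intro Z hAS
    unfold tail
    congr 1
    ext ω'
    simp only [Set.mem_ofPred_eq, hAS, true_and, max_lt_iff, div_lt_iff₀' hω]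
  by_cases hAS : A ω ∈ S
  · simp only [key _ hAS]
    exact h _ (le_max_left _ _)
  · simp [hAS]

/-! ### Products of two independent copies of A -/

/-- A positive random variable `A` with an independent copy `A'`, whose right tail is regularly
varying with index `-α` and satisfies the convolution condition, and with `𝔼[A ^ α] < 1`. -/
structure ConvolutionTail (P : Measure Ω) (A A' : Ω → ℝ) (α : ℝ) : Prop where
  meas : Measurable A
  meas' : Measurable A'
  indep : IndepFun A A' P
  ident : IdentDistrib A' A P P
  pos : ∀ᵐ ω ∂P, 0 < A ω
  index_pos : 0 < α
  regular : ∀ y : ℝ, 0 < y →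
    TailEquiv (fun t => tail P A (t * y)) (fun t => y ^ (-α) * tail P A t)
  integrable : Integrable (fun ω => A ω ^ α) P
  conv : TailEquiv (fun t => tail P (fun ω => A ω * A' ω) t)
    (fun t => 2 * (∫ ω, A ω ^ α ∂P) * tail P A t)
  moment_lt_one : ∫ ω, A ω ^ α ∂P < 1

/-- The truncated moment `𝔼[A ^ α; A ≤ K]`. -/
noncomputable def truncatedMoment (P : Measure Ω) (A : Ω → ℝ) (α K : ℝ) : ℝ :=
  ∫ ω in {ω | A ω ≤ K}, A ω ^ α ∂P

namespace ConvolutionTail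

variable {A A' : Ω → ℝ} {α : ℝ}

theorem truncatedMoment_le (h : ConvolutionTail P A A' α) (K : ℝ) :
    truncatedMoment P A α K ≤ ∫ ω, A ω ^ α ∂P :=
  setIntegral_le_integral h.integrable (by
    filter_upwards [h.pos] with ω hω using (Real.rpow_pos_of_pos hω α).le)

theorem tendsto_truncatedMoment (h : ConvolutionTail P A A' α) :
    Tendsto (truncatedMoment P A α) atTop (𝓝 (∫ ω, A ω ^ α ∂P)) := by
  have h1 : ∀ K, truncatedMoment P A α K =
      ∫ ω, {ω | A ω ≤ K}.indicator (fun ω => A ω ^ α) ω ∂P := fun K =>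
    (integral_indicator (measurableSet_le h.meas measurable_const)).symm
  rw [funext h1]
  refine tendsto_integral_filter_of_dominated_convergence (fun ω => ‖A ω ^ α‖)
    (Eventually.of_forall fun K => ?_) (Eventually.of_forall fun K => ae_of_all _ fun ω =>
      norm_indicator_le_norm_self _ _) h.integrable.norm (ae_of_all _ fun ω => ?_)
  · exact h.integrable.aestronglyMeasurable.indicator (measurableSet_le h.meas measurable_const)
  · refine tendsto_const_nhds.congr' ?_
    filter_upwards [eventually_ge_atTop (A ω)] with K hK
    simp [hK]

variable [IsProbabilityMeasure P]

/-- Since x / 0 = 0, a quotient tending to 1 excludes a vanishing tail at arbitrarily large levels;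
monotonicity does the rest. -/
theorem tail_pos (h : ConvolutionTail P A A' α) (t : ℝ) : 0 < tail P A t := by
  have h1 := (h.regular 1 one_pos).eventually (lt_mem_nhds one_half_lt_one)
  obtain ⟨s, hs, hts⟩ := (h1.and (eventually_ge_atTop t)).exists
  refine lt_of_lt_of_le ?_ (tail_antitone A hts)
  refine (tail_nonneg A s).lt_of_ne fun h0 => ?_
  simp [← h0] at hs
  linarith

theorem tendsto_tail_mul (h : ConvolutionTail P A A' α) {y : ℝ} (hy : 0 < y) :
    Tendsto (fun t => tail P A (t * y) / tail P A t) atTop (𝓝 (y ^ (-α))) := by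
  have h1 := (h.regular y hy).const_mul (y ^ (-α))
  rw [mul_one] at h1
  refine h1.congr fun t => ?_
  have := (h.tail_pos t).ne'
  have := (Real.rpow_pos_of_pos hy (-α)).ne'
  field_simp

theorem tendsto_div_tail_comp_mul (h : ConvolutionTail P A A' α) {G : ℝ → ℝ} {c : ℝ}
    (hG : Tendsto (fun t => G t / tail P A t) atTop (𝓝 c)) {y : ℝ} (hy : 0 < y) :
    Tendsto (fun t => G (t * y) / tail P A t) atTop (𝓝 (c * y ^ (-α))) := by
  refine ((hG.comp (tendsto_id.atTop_mul_const hy)).mul (h.tendsto_tail_mul hy)).congr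
    fun t => ?_
  have := (h.tail_pos t).ne'
  have := (h.tail_pos (t * y)).ne'
  simp only [Function.comp, id]
  field_simp

theorem tendsto_tail_zero (h : ConvolutionTail P A A' α) : Tendsto (tail P A) atTop (𝓝 0) := by
  have h1 : Tendsto (fun n : ℝ => P {ω | n < A ω}) atTop (𝓝 (P (⋂ n : ℝ, {ω | n < A ω}))) :=
    tendsto_measure_iInter_atTop
      (fun n => (measurableSet_lt measurable_const h.meas).nullMeasurableSet)
      (fun s t hst ω hω => lt_of_le_of_lt hst hω) ⟨0, measure_ne_top _ _⟩
  have h2 : (⋂ n : ℝ, {ω | n < A ω}) = ∅ := by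
    ext ω
    simp only [Set.mem_iInter, Set.mem_ofPred_eq, Set.mem_empty_iff_false, iff_false, not_forall]
    exact ⟨A ω, lt_irrefl _⟩
  rw [h2, measure_empty] at h1
  exact (ENNReal.tendsto_toReal ENNReal.zero_ne_top).comp h1

theorem moment_pos (h : ConvolutionTail P A A' α) : 0 < ∫ ω, A ω ^ α ∂P := by
  have h0 : 0 ≤ᵐ[P] fun ω => A ω ^ α := by
    filter_upwards [h.pos] with ω hω using (Real.rpow_pos_of_pos hω α).le
  refine (integral_nonneg_of_ae h0).lt_of_ne fun h1 => ?_
  have h2 := (integral_eq_zero_iff_of_nonneg_ae h0 h.integrable).1 h1.symm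
  obtain ⟨ω, h3, h4⟩ := (h2.and h.pos).exists
  exact (Real.rpow_pos_of_pos h4 α).ne' h3

/-- `ℙ[A * A' > s, A ≤ K] ∼ 𝔼[A ^ α; A ≤ K] ℙ[A > s]`. -/
theorem tendsto_product_of_le (h : ConvolutionTail P A A' α) {K : ℝ} (hK : 0 < K) :
    Tendsto (fun s => P.real {ω | A ω ≤ K ∧ s < A ω * A' ω} / tail P A s) atTop
      (𝓝 (truncatedMoment P A α K)) := by
  have hT : ∀ s, MeasurableSet {p : ℝ × ℝ | p.1 ≤ K ∧ s < p.1 * p.2} := fun s =>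
    (measurableSet_le measurable_fst measurable_const).inter
      (measurableSet_lt measurable_const (measurable_fst.mul measurable_snd))
  have hKset : MeasurableSet {ω | A ω ≤ K} := measurableSet_le h.meas measurable_const
  have h1 : ∀ s, P.real {ω | A ω ≤ K ∧ s < A ω * A' ω} / tail P A s =
      ∫ ω, {ω | A ω ≤ K}.indicator (fun ω => tail P A (s / A ω) / tail P A s) ω ∂P := by
    intro s
    have e1 := measureReal_eq_integral_of_indepFun h.meas h.meas' h.indep (hT s)
    simp only [Set.mem_ofPred_eq] at e1
    rw [e1, ← integral_div]
    refine integral_congr_ae ?_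
    filter_upwards [h.pos] with ω hω
    by_cases hAK : A ω ≤ K
    · simp only [hAK, true_and, Set.indicator, Set.mem_ofPred_eq, if_true]
      rw [← h.ident.tail_eq (s / A ω)]
      unfold tail
      congr 2
      ext ω'
      simp only [Set.mem_ofPred_eq, div_lt_iff₀' hω]
    · simp [hAK]
  have h2 : truncatedMoment P A α K =
      ∫ ω, {ω | A ω ≤ K}.indicator (fun ω => A ω ^ α) ω ∂P := (integral_indicator hKset).symm
  rw [funext h1, h2]
  -- On A ≤ K the integrand is at most F(s/K)/F(s), which converges to K^α; a constant therefore
  -- dominates for large s.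
  have hbd : ∀ᶠ s in atTop, tail P A (s * K⁻¹) / tail P A s < (K⁻¹) ^ (-α) + 1 :=
    (h.tendsto_tail_mul (inv_pos.2 hK)).eventually (gt_mem_nhds (lt_add_one _))
  refine tendsto_integral_filter_of_dominated_convergence (fun ω => (K⁻¹) ^ (-α) + 1)
    (Eventually.of_forall fun s => ?_) ?_ (integrable_const _) ?_
  · refine Measurable.aestronglyMeasurable (Measurable.indicator ?_ hKset)
    exact ((tail_antitone A).measurable.comp (measurable_const.div h.meas)).div_const _
  · filter_upwards [hbd, eventually_ge_atTop 0] with s hs hs0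
    filter_upwards [h.pos] with ω hω
    have hnn : 0 ≤ K⁻¹ ^ (-α) + 1 := by positivity
    by_cases hAK : A ω ≤ K
    · simp only [hAK, Set.indicator, Set.mem_ofPred_eq, if_true]
      rw [Real.norm_of_nonneg (div_nonneg (tail_nonneg _ _) (tail_nonneg _ _))]
      refine le_trans ?_ hs.le
      refine div_le_div_of_nonneg_right (tail_antitone A ?_) (tail_nonneg _ _)
      rw [← div_eq_mul_inv]
      exact div_le_div_of_nonneg_left hs0 hω hAK
    · simpa [hAK] using hnn
  · filter_upwards [h.pos] with ω hω
    by_cases hAK : A ω ≤ K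
    · simp only [hAK, Set.indicator, Set.mem_ofPred_eq, if_true]
      have := h.tendsto_tail_mul (inv_pos.2 hω)
      rw [Real.rpow_neg (inv_pos.2 hω).le, Real.inv_rpow hω.le, inv_inv] at this
      simpa only [div_eq_mul_inv] using this
    · simp [hAK]

/-- `ℙ[A * A' > s, A > K, A' > K] ∼ 2 𝔼[A ^ α; A > K] ℙ[A > s]`. -/
theorem tendsto_product_of_gt (h : ConvolutionTail P A A' α) {K : ℝ} (hK : 0 < K) :
    Tendsto (fun s => P.real {ω | K < A ω ∧ K < A' ω ∧ s < A ω * A' ω} / tail P A s) atTop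
      (𝓝 (2 * (∫ ω, A ω ^ α ∂P - truncatedMoment P A α K))) := by
  have h1 : Tendsto (fun s => tail P (fun ω => A ω * A' ω) s / tail P A s) atTop
      (𝓝 (2 * ∫ ω, A ω ^ α ∂P)) := by
    have h2 := h.conv.const_mul (2 * ∫ ω, A ω ^ α ∂P)
    rw [mul_one] at h2
    refine h2.congr fun t => ?_
    have := (h.tail_pos t).ne'
    have := h.moment_pos.ne'
    field_simp
  have h3 := h.tendsto_product_of_le hK
  have h4 := (h1.sub h3).sub h3
  have e : 2 * (∫ ω, A ω ^ α ∂P) - truncatedMoment P A α K - truncatedMoment P A α K =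
      2 * (∫ ω, A ω ^ α ∂P - truncatedMoment P A α K) := by ring
  rw [e] at h4
  refine h4.congr' ?_
  -- For s ≥ K² the events A ≤ K and A' ≤ K exclude each other on AA' > s, so subtracting both
  -- removes nothing twice.
  filter_upwards [eventually_ge_atTop (K * K)] with s hs
  rw [← sub_div, ← sub_div]
  congr 1
  have hsymm : P.real {ω | A' ω ≤ K ∧ s < A ω * A' ω} =
      P.real {ω | A ω ≤ K ∧ s < A ω * A' ω} := by
    have hT : MeasurableSet {p : ℝ × ℝ | p.1 ≤ K ∧ s < p.2 * p.1} :=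
      (measurableSet_le measurable_fst measurable_const).inter
        (measurableSet_lt measurable_const (measurable_snd.mul measurable_fst))
    have hid : IdentDistrib (fun ω => (A' ω, A ω)) (fun ω => (A ω, A' ω)) P P :=
      h.ident.prodMk h.ident.symm h.indep.symm h.indep
    have := hid.measure_mem_eq hT
    simp only [measureReal_def]
    refine congrArg ENNReal.toReal ?_
    refine (this.trans ?_)
    congr 1
    ext ω
    simp [mul_comm]
  have m1 : MeasurableSet {ω | A ω ≤ K} := measurableSet_le h.meas measurable_const
  have m2 : MeasurableSet {ω | A' ω ≤ K} := measurableSet_le h.meas' measurable_const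
  have m3 : MeasurableSet {ω | s < A ω * A' ω} :=
    measurableSet_lt measurable_const (h.meas.mul h.meas')
  have e1 : tail P (fun ω => A ω * A' ω) s = P.real {ω | A ω ≤ K ∧ s < A ω * A' ω} +
      P.real {ω | K < A ω ∧ s < A ω * A' ω} := by
    unfold tail
    rw [← measureReal_inter_add_sdiff (s := {ω | s < A ω * A' ω}) m1]
    congr 2
    · ext ω; simp [and_comm]
    · ext ω; simp [and_comm]
  have e2 : P.real {ω | K < A ω ∧ s < A ω * A' ω} = P.real {ω | A' ω ≤ K ∧ s < A ω * A' ω} +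
      P.real {ω | K < A ω ∧ K < A' ω ∧ s < A ω * A' ω} := by
    rw [← measureReal_inter_add_sdiff (s := {ω | K < A ω ∧ s < A ω * A' ω}) m2]
    congr 1
    · refine measureReal_congr ?_
      filter_upwards [h.pos] with ω hω
      refine propext ⟨fun hx => ⟨hx.2, hx.1.2⟩, fun hx => ⟨⟨?_, hx.2⟩, hx.1⟩⟩
      by_contra hcon
      have hx1 : A' ω ≤ K := hx.1
      have hx2 : s < A ω * A' ω := hx.2
      have hx3 : A ω ≤ K := not_lt.1 hcon
      have : A ω * A' ω ≤ K * K := by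
        calc A ω * A' ω ≤ A ω * K := by gcongr
          _ ≤ K * K := by gcongr
      linarith
    · congr 1
      ext ω
      simp only [Set.mem_sdiff, Set.mem_ofPred_eq, not_le]
      tauto
  rw [e1, e2, hsymm]
  ring

end ConvolutionTail

/-! ### Self-improving asymptotic bounds -/

/-- A bounded nonnegative function that asymptotically improves each of its upper bounds `L` and
lower bounds `l` to `e + ρ L` and `e + ρ l`, where `ρ < 1`, converges to `e / (1 - ρ)`. -/
theorem tendsto_of_affine_bounds {u : ℝ → ℝ} {e ρ C : ℝ} (hρ0 : 0 ≤ ρ) (hρ : ρ < 1)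
    (hC : ∀ᶠ t in atTop, u t ≤ C) (h0 : ∀ t, 0 ≤ u t)
    (hup : ∀ L, 0 ≤ L → (∀ᶠ t in atTop, u t ≤ L) → ∀ ε > 0, ∀ᶠ t in atTop, u t ≤ e + ρ * L + ε)
    (hlow : ∀ l, 0 ≤ l → (∀ᶠ t in atTop, l ≤ u t) → ∀ ε > 0, ∀ᶠ t in atTop,
      e + ρ * l - ε ≤ u t) :
    Tendsto u atTop (𝓝 (e / (1 - ρ))) := by
  have h1ρ : 0 < 1 - ρ := sub_pos.2 hρ
  have hnn : ∀ L, (∀ᶠ t in atTop, u t ≤ L) → 0 ≤ L := fun L hL => by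
    obtain ⟨t, ht⟩ := hL.exists
    exact (h0 t).trans ht
  -- The infimum of U and the supremum of V play the roles of limsup and liminf. Improving a nearly
  -- optimal bound gives inf U ≤ e + ρ inf U and sup V ≥ e + ρ sup V.
  set U : Set ℝ := {L | ∀ᶠ t in atTop, u t ≤ L} with hU
  set V : Set ℝ := {l | 0 ≤ l ∧ ∀ᶠ t in atTop, l ≤ u t} with hV
  have hUne : U.Nonempty := ⟨C, hC⟩
  have hUbd : BddBelow U := ⟨0, fun L hL => hnn L hL⟩
  have hVne : V.Nonempty := ⟨0, le_rfl, Eventually.of_forall h0⟩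
  have hVbd : BddAbove V := ⟨C, fun l hl => by
    obtain ⟨t, h1, h2⟩ := (hl.2.and hC).exists
    exact h1.trans h2⟩
  have hUle : sInf U ≤ e / (1 - ρ) := by
    rw [le_div_iff₀ h1ρ]
    refine le_of_forall_pos_le_add fun ε hε => ?_
    obtain ⟨L, hL, hLlt⟩ := exists_lt_of_csInf_lt hUne (lt_add_of_pos_right (sInf U) (half_pos hε))
    have h2 := csInf_le hUbd (show e + ρ * L + ε / 2 ∈ U from hup L (hnn L hL) hL _ (half_pos hε))
    nlinarith
  have hVle : e / (1 - ρ) ≤ sSup V := by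
    rw [div_le_iff₀ h1ρ]
    refine le_of_forall_pos_le_add fun ε hε => ?_
    obtain ⟨l, hl, hlt⟩ := exists_lt_of_lt_csSup hVne (sub_lt_self (sSup V) (half_pos hε))
    have h1 := hlow l hl.1 hl.2 _ (half_pos hε)
    have h2 : max 0 (e + ρ * l - ε / 2) ≤ sSup V := by
      refine le_csSup hVbd ⟨le_max_left _ _, ?_⟩
      filter_upwards [h1] with t ht using max_le (h0 t) ht
    have h3 := (le_max_right _ _).trans h2
    nlinarith
  refine tendsto_order.2 ⟨fun a ha => ?_, fun a ha => ?_⟩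
  · obtain ⟨l, hl, hlt⟩ := exists_lt_of_lt_csSup hVne (ha.trans_le hVle)
    filter_upwards [hl.2] with t ht using hlt.trans_le ht
  · obtain ⟨L, hL, hLt⟩ := exists_lt_of_csInf_lt hUne (hUle.trans_lt ha)
    filter_upwards [hL] with t ht using lt_of_le_of_lt ht hLt

/-- Serves to choose δ: the price (1 ± δ)^(-α) of moving the level from t to (1 ± δ)t disappears as
δ ↓ 0. -/
theorem tendsto_const_mul_rpow_neg (c α : ℝ) {g : ℝ → ℝ} (hg : Continuous g) (hg0 : g 0 = 1) :
    Tendsto (fun δ : ℝ => c * g δ ^ (-α)) (𝓝[>] 0) (𝓝 c) := by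
  have h1 : Tendsto g (𝓝[>] 0) (𝓝 1) := by
    have := hg.tendsto 0
    rw [hg0] at this
    exact this.mono_left nhdsWithin_le_nhds
  have h2 := (h1.rpow_const (p := -α) (Or.inl one_ne_zero)).const_mul c
  simpa using h2

/-! ### Tails of A Y + B with Y independent of A or of (A, B) -/

namespace ConvolutionTail

variable [IsProbabilityMeasure P] {A A' : Ω → ℝ} {α : ℝ}

/-- Contribution of the bounded values of the factor `A` to the tail of `A * Y`. -/
theorem measureReal_le_of_tail_le (h : ConvolutionTail P A A' α) {Y : Ω → ℝ} (hY : Measurable Y)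
    (hAY : IndepFun A Y P) {L T K : ℝ} (hT : 0 ≤ T) (hL0 : 0 ≤ L)
    (hL : ∀ t, T ≤ t → tail P Y t ≤ L * tail P A t) {s : ℝ} (hs : K * T ≤ s) :
    P.real {ω | A ω ≤ K ∧ s < A ω * Y ω} ≤ L * P.real {ω | A ω ≤ K ∧ s < A ω * A' ω} := by
  have h1 := measureReal_product_le h.meas hY h.meas' hAY h.indep h.pos (c := 1) (C := L)
    (k := T) (fun t ht => by rw [one_mul, h.ident.tail_eq]; exact hL t ht)
    (measurableSet_Iic (a := K)) s
  rw [one_mul] at h1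
  refine le_trans ?_ (h1.trans (mul_le_mul_of_nonneg_left
    (measureReal_mono fun ω hω => ⟨hω.1, hω.2.2⟩) hL0))
  -- The restriction Y > T is free: A ≤ K and AY > s ≥ KT already force it.
  refine ENNReal.toReal_mono (measure_ne_top _ _) (measure_mono_ae ?_)
  filter_upwards [h.pos] with ω hω hx
  refine ⟨hx.1, ?_, hx.2⟩
  by_contra hcon
  have hx1 : A ω ≤ K := hx.1
  have hx2 : s < A ω * Y ω := hx.2
  have : A ω * Y ω ≤ K * T :=
    calc A ω * Y ω ≤ A ω * T := by gcongr; exact not_lt.1 hcon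
      _ ≤ K * T := by gcongr
  linarith

/-- Contribution of the large values of both factors to the tail of `A * Y`. -/
theorem measureReal_gt_of_tail_le (h : ConvolutionTail P A A' α) {Y : Ω → ℝ} (hY : Measurable Y)
    (hAY : IndepFun A Y P) {C K : ℝ} (hC : ∀ t, tail P Y t ≤ C * tail P A t) (s : ℝ) :
    P.real {ω | K < A ω ∧ K < Y ω ∧ s < A ω * Y ω} ≤
      C * P.real {ω | K < A ω ∧ K < A' ω ∧ s < A ω * A' ω} := by
  have h1 := measureReal_product_le h.meas hY h.meas' hAY h.indep h.pos (c := 1) (C := C)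
    (k := K) (fun t _ => by rw [one_mul, h.ident.tail_eq]; exact hC t)
    (measurableSet_Ioi (a := K)) s
  rw [one_mul] at h1
  exact h1

/-- A tail bound `ℙ[Y > t] ≤ C ℙ[A > t]` passes to `A * Y + W`, with `C` replaced by `θ C + D`
where `θ < 1`. -/
theorem exists_affine_tail_bound (h : ConvolutionTail P A A' α) {W : Ω → ℝ} {c : ℝ}
    (hc : ∀ t, tail P W t ≤ c * tail P A t) :
    ∃ θ D t₀ : ℝ, 0 ≤ θ ∧ θ < 1 ∧ 0 ≤ D ∧ ∀ Y : Ω → ℝ, Measurable Y → IndepFun A Y P →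
      ∀ C, 0 ≤ C → (∀ t, tail P Y t ≤ C * tail P A t) → ∀ t, t₀ ≤ t →
        tail P (fun ω => A ω * Y ω + W ω) t ≤ (θ * C + D) * tail P A t := by
  set ρ := ∫ ω, A ω ^ α ∂P with hρ
  obtain ⟨δ, hδ, hδ0, hδ1⟩ : ∃ δ : ℝ, ρ * (1 - δ) ^ (-α) < 1 ∧ 0 < δ ∧ δ < 1 := by
    have h1 := (tendsto_const_mul_rpow_neg ρ α (g := fun δ => 1 - δ) (by fun_prop)
      (by simp)).eventually (gt_mem_nhds h.moment_lt_one)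
    exact (h1.and (Ioo_mem_nhdsGT one_pos)).exists
  have hδ' : 0 < 1 - δ := sub_pos.2 hδ1
  -- Here 2ρ - ρ_K = ρ_K + 2(ρ - ρ_K) collects the cases A ≤ K and both factors above K. It
  -- decreases to ρ, so the contraction survives for large K.
  obtain ⟨K, hK, hK0⟩ : ∃ K : ℝ, (2 * ρ - truncatedMoment P A α K) * (1 - δ) ^ (-α) < 1 ∧
      0 < K := by
    have h1 : Tendsto (fun K => (2 * ρ - truncatedMoment P A α K) * (1 - δ) ^ (-α)) atTop
        (𝓝 ((2 * ρ - ρ) * (1 - δ) ^ (-α))) :=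
      (tendsto_const_nhds.sub h.tendsto_truncatedMoment).mul_const _
    have e : (2 * ρ - ρ) * (1 - δ) ^ (-α) = ρ * (1 - δ) ^ (-α) := by ring
    rw [e] at h1
    exact ((h1.eventually (gt_mem_nhds hδ)).and (eventually_gt_atTop 0)).exists
  obtain ⟨θ, hθ, hθ1⟩ := exists_between hK
  have hθ0 : 0 ≤ θ := by
    refine le_trans (mul_nonneg ?_ (Real.rpow_nonneg hδ'.le _)) hθ.le
    have := h.truncatedMoment_le K
    have := h.moment_pos
    linarith
  have hG := ((h.tendsto_product_of_le hK0).add (h.tendsto_product_of_gt hK0))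
  have e : truncatedMoment P A α K + 2 * (ρ - truncatedMoment P A α K) =
    2 * ρ - truncatedMoment P A α K := by ring
  rw [← hρ, e] at hG
  simp only [← add_div] at hG
  have hG' := (h.tendsto_div_tail_comp_mul hG hδ').eventually (gt_mem_nhds hθ)
  have hD := (((h.tendsto_tail_mul hδ0).const_mul c).add
    (h.tendsto_tail_mul (div_pos hδ' hK0))).eventually (gt_mem_nhds (lt_add_one _))
  -- The terms account for W > tδ, for Y ≤ K (which forces A > t(1 - δ)/K), and for slack.
  set D := c * δ ^ (-α) + ((1 - δ) / K) ^ (-α) + 1 with hDdef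
  have hc0 : 0 ≤ c := by
    have := (tail_nonneg W 0).trans (hc 0)
    exact nonneg_of_mul_nonneg_left this (h.tail_pos 0)
  have hD0 : 0 ≤ D := by positivity
  -- The threshold t₀ is fixed before Y and C, so the bound can be iterated.
  obtain ⟨t₀, ht₀⟩ := eventually_atTop.1 ((hG'.and hD).and (eventually_ge_atTop 0))
  refine ⟨θ, D, t₀, hθ0, hθ1, hD0, fun Y hY hAY C hC0 hC t ht => ?_⟩
  obtain ⟨⟨hG1, hD1⟩, ht0⟩ := ht₀ t ht
  have hF := h.tail_pos t
  rw [div_lt_iff₀ hF] at hG1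
  rw [mul_div_assoc', ← add_div, div_lt_iff₀ hF] at hD1
  have hs0 : 0 ≤ t * (1 - δ) := by positivity
  have b1 := h.measureReal_le_of_tail_le hY hAY le_rfl hC0 (fun t _ => hC t)
    (K := K) (s := t * (1 - δ)) (by simpa using hs0)
  have b2 := h.measureReal_gt_of_tail_le hY hAY hC (K := K) (t * (1 - δ))
  have b3 := hc (t * δ)
  have hincl : tail P (fun ω => A ω * Y ω + W ω) t ≤
      P.real (({ω | t * δ < W ω} ∪ {ω | A ω ≤ K ∧ t * (1 - δ) < A ω * Y ω}) ∪
        ({ω | K < A ω ∧ K < Y ω ∧ t * (1 - δ) < A ω * Y ω} ∪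
          {ω | t * ((1 - δ) / K) < A ω})) := by
    refine ENNReal.toReal_mono (measure_ne_top _ _) (measure_mono_ae ?_)
    filter_upwards [h.pos] with ω hω hx
    have hx1 : t < A ω * Y ω + W ω := hx
    by_cases g1 : t * δ < W ω
    · exact Or.inl (Or.inl g1)
    have g2 : t * (1 - δ) < A ω * Y ω := by
      have := not_lt.1 g1
      linarith
    by_cases g3 : A ω ≤ K
    · exact Or.inl (Or.inr ⟨g3, g2⟩)
    by_cases g4 : K < Y ω
    · exact Or.inr (Or.inl ⟨not_le.1 g3, g4, g2⟩)
    · refine Or.inr (Or.inr ?_)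
      change t * ((1 - δ) / K) < A ω
      rw [← mul_div_assoc, div_lt_iff₀ hK0]
      refine g2.trans_le ?_
      gcongr
      exact not_lt.1 g4
  have hu := (measureReal_union_le (μ := P)
    ({ω | t * δ < W ω} ∪ {ω | A ω ≤ K ∧ t * (1 - δ) < A ω * Y ω})
    ({ω | K < A ω ∧ K < Y ω ∧ t * (1 - δ) < A ω * Y ω} ∪ {ω | t * ((1 - δ) / K) < A ω}))
  have hu1 := (measureReal_union_le (μ := P)
    {ω | t * δ < W ω} {ω | A ω ≤ K ∧ t * (1 - δ) < A ω * Y ω})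
  have hu2 := (measureReal_union_le (μ := P)
    {ω | K < A ω ∧ K < Y ω ∧ t * (1 - δ) < A ω * Y ω} {ω | t * ((1 - δ) / K) < A ω})
  have e1 : P.real {ω | t * δ < W ω} = tail P W (t * δ) := rfl
  have e2 : P.real {ω | t * ((1 - δ) / K) < A ω} = tail P A (t * ((1 - δ) / K)) := rfl
  rw [e1] at hu1
  rw [e2] at hu2
  have hCG := mul_le_mul_of_nonneg_left hG1.le hC0
  nlinarith

/-- The tail of `A * Y + B` on the event that `Y` is bounded. -/
theorem tendsto_bounded_part (h : ConvolutionTail P A A' α) {B Y : Ω → ℝ} (hB : Measurable B)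
    (hY : Measurable Y) (hindep : IndepFun (fun ω => (A ω, B ω)) Y P) {c : ℝ}
    (hc : ∀ t, tail P (fun ω => |B ω|) t ≤ c * tail P A t) {f : ℝ → ℝ} (hf : Measurable f)
    (hf0 : ∀ y, 0 ≤ f y)
    (hlim : ∀ᵐ ω ∂P, Tendsto (fun t => tail P (fun ω' => A ω' * Y ω + B ω') t / tail P A t)
      atTop (𝓝 (f (Y ω)))) {K : ℝ} (hK : 0 < K) :
    IntegrableOn (fun ω => f (Y ω)) {ω | |Y ω| ≤ K} P ∧
      Tendsto (fun t => P.real {ω | |Y ω| ≤ K ∧ t < A ω * Y ω + B ω} / tail P A t) atTop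
        (𝓝 (∫ ω in {ω | |Y ω| ≤ K}, f (Y ω) ∂P)) := by
  have hKset : MeasurableSet {ω | |Y ω| ≤ K} := measurableSet_le hY.abs measurable_const
  have hAB : Measurable fun ω => (A ω, B ω) := h.meas.prodMk hB
  have hmeasS : ∀ t, MeasurableSet {p : ℝ × (ℝ × ℝ) | t < p.2.1 * p.1 + p.2.2} := fun t =>
    measurableSet_lt measurable_const (by fun_prop)
  have hmt : ∀ t, Measurable fun y : ℝ => tail P (fun ω' => A ω' * y + B ω') t := fun t =>
    measurable_measureReal_section hAB (hmeasS t)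
  -- uniform bound
  set D := ((2 * K)⁻¹) ^ (-α) + c * (2⁻¹ : ℝ) ^ (-α) + 1 with hD
  have hbd : ∀ᶠ t in atTop, ∀ y, |y| ≤ K →
      tail P (fun ω' => A ω' * y + B ω') t / tail P A t ≤ D := by
    have h1 := ((h.tendsto_tail_mul (inv_pos.2 (mul_pos two_pos hK))).add
      ((h.tendsto_tail_mul (inv_pos.2 two_pos)).const_mul c)).eventually
        (gt_mem_nhds (lt_add_one _))
    filter_upwards [h1] with t h1 y hy
    refine le_trans ?_ h1.le
    rw [mul_div_assoc', ← add_div]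
    refine div_le_div_of_nonneg_right ?_ (tail_nonneg _ _)
    refine le_trans ?_ (add_le_add_right (hc (t * 2⁻¹)) _)
    refine le_trans ?_ (measureReal_union_le _ _)
    refine ENNReal.toReal_mono (measure_ne_top _ _) (measure_mono_ae ?_)
    filter_upwards [h.pos] with ω hω hx
    have hx1 : t < A ω * y + B ω := hx
    -- If |B| ≤ t/2, then AK ≥ Ay > t/2, hence A > t/(2K), uniformly in |y| ≤ K.
    by_cases g : t * 2⁻¹ < |B ω|
    · exact Or.inr g
    · left
      change t * (2 * K)⁻¹ < A ω
      rw [← div_eq_mul_inv, div_lt_iff₀ (by positivity)]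
      have g1 := (le_abs_self _).trans (not_lt.1 g)
      have : A ω * y ≤ A ω * K := by
        gcongr
        exact (le_abs_self y).trans hy
      linarith
  have hflim : ∀ᵐ ω ∂P, |Y ω| ≤ K → f (Y ω) ≤ D := by
    filter_upwards [hlim] with ω hω hYK
    exact le_of_tendsto hω (hbd.mono fun t ht => ht _ hYK)
  have hint : IntegrableOn (fun ω => f (Y ω)) {ω | |Y ω| ≤ K} P := by
    refine Measure.integrableOn_of_bounded (M := D) (measure_ne_top _ _)
      (hf.comp hY).aestronglyMeasurable ?_
    rw [ae_restrict_iff' hKset]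
    filter_upwards [hflim] with ω hω hYK
    rw [Real.norm_of_nonneg (hf0 _)]
    exact hω hYK
  refine ⟨hint, ?_⟩
  have h1 : ∀ t, P.real {ω | |Y ω| ≤ K ∧ t < A ω * Y ω + B ω} / tail P A t =
      ∫ ω in {ω | |Y ω| ≤ K}, tail P (fun ω' => A ω' * Y ω + B ω') t / tail P A t ∂P := by
    intro t
    have hT : MeasurableSet {p : ℝ × (ℝ × ℝ) | |p.1| ≤ K ∧ t < p.2.1 * p.1 + p.2.2} :=
      (measurableSet_le measurable_fst.abs measurable_const).inter (hmeasS t)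
    have e1 := measureReal_eq_integral_of_indepFun hY hAB hindep.symm hT
    simp only [Set.mem_ofPred_eq] at e1
    rw [e1, integral_div, ← integral_indicator hKset]
    congr 1
    refine integral_congr_ae (ae_of_all _ fun ω => ?_)
    by_cases hYK : |Y ω| ≤ K
    · simp [hYK, tail]
    · simp [hYK]
  rw [funext h1]
  refine tendsto_integral_filter_of_dominated_convergence (fun _ => D)
    (Eventually.of_forall fun t => ?_) ?_ (integrable_const _) (ae_restrict_of_ae hlim)
  · exact (((hmt t).comp hY).div_const _).aestronglyMeasurable
  · filter_upwards [hbd] with t ht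
    rw [ae_restrict_iff' hKset]
    refine ae_of_all _ fun ω hω => ?_
    rw [Real.norm_of_nonneg (div_nonneg (tail_nonneg _ _) (tail_nonneg _ _))]
    exact ht _ hω

end ConvolutionTail

/-- The tail of |B| may be of the same order as F, so it is not negligible by itself; the factor
ℙ[|Y| > K] gained from independence makes this event harmless as K → ∞. -/
theorem measureReal_abs_and_abs {A B Y : Ω → ℝ} (hindep : IndepFun (fun ω => (A ω, B ω)) Y P)
    (s K : ℝ) : P.real {ω | K < |Y ω| ∧ s < |B ω|} =
      tail P (fun ω => |B ω|) s * tail P (fun ω => |Y ω|) K := by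
  have h1 : IndepFun (fun ω => |B ω|) (fun ω => |Y ω|) P :=
    hindep.comp (φ := fun p : ℝ × ℝ => |p.2|) (ψ := fun y : ℝ => |y|)
      (by fun_prop) (by fun_prop)
  have h2 := h1.measure_inter_preimage_eq_mul (Set.Ioi s) (Set.Ioi K) measurableSet_Ioi
    measurableSet_Ioi
  unfold tail
  simp only [measureReal_def]
  rw [← ENNReal.toReal_mul]
  refine congrArg ENNReal.toReal (Eq.trans ?_ h2)
  congr 1
  ext ω
  exact and_comm

namespace ConvolutionTail

variable [IsProbabilityMeasure P] {A A' : Ω → ℝ} {α : ℝ}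

/-- Upper bound for the tail of `A * Y + B` in terms of an upper bound for the tail of `Y`. -/
theorem tail_affine_le (h : ConvolutionTail P A A' α) {B Y : Ω → ℝ} (hY : Measurable Y)
    (hindep : IndepFun (fun ω => (A ω, B ω)) Y P) {c C L T δ K t : ℝ}
    (hc : ∀ t, tail P (fun ω => |B ω|) t ≤ c * tail P A t)
    (hC : ∀ t, tail P Y t ≤ C * tail P A t) (hL0 : 0 ≤ L) (hT : 0 ≤ T)
    (hL : ∀ t, T ≤ t → tail P Y t ≤ L * tail P A t) (ht : K * T ≤ t * (1 - δ)) (ht0 : 0 ≤ t)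
    (hδ : δ < 1) :
    tail P (fun ω => A ω * Y ω + B ω) t ≤
      P.real {ω | |Y ω| ≤ K ∧ t < A ω * Y ω + B ω} +
      c * tail P A (t * δ) * tail P (fun ω => |Y ω|) K +
      L * P.real {ω | A ω ≤ K ∧ t * (1 - δ) < A ω * A' ω} +
      C * P.real {ω | K < A ω ∧ K < A' ω ∧ t * (1 - δ) < A ω * A' ω} := by
  have hAY : IndepFun A Y P := hindep.comp measurable_fst measurable_id
  have b1 := h.measureReal_le_of_tail_le hY hAY hT hL0 hL ht
  have b2 := h.measureReal_gt_of_tail_le hY hAY hC (K := K) (t * (1 - δ))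
  have b3 : P.real {ω | K < |Y ω| ∧ t * δ < |B ω|} ≤
      c * tail P A (t * δ) * tail P (fun ω => |Y ω|) K := by
    rw [measureReal_abs_and_abs hindep]
    exact mul_le_mul_of_nonneg_right (hc _) (tail_nonneg _ _)
  have hincl : tail P (fun ω => A ω * Y ω + B ω) t ≤
      P.real (({ω | |Y ω| ≤ K ∧ t < A ω * Y ω + B ω} ∪ {ω | K < |Y ω| ∧ t * δ < |B ω|}) ∪
        ({ω | A ω ≤ K ∧ t * (1 - δ) < A ω * Y ω} ∪
          {ω | K < A ω ∧ K < Y ω ∧ t * (1 - δ) < A ω * Y ω})) := by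
    refine ENNReal.toReal_mono (measure_ne_top _ _) (measure_mono_ae ?_)
    filter_upwards [h.pos] with ω hω hx
    have hx1 : t < A ω * Y ω + B ω := hx
    by_cases g1 : |Y ω| ≤ K
    · exact Or.inl (Or.inl ⟨g1, hx1⟩)
    by_cases g2 : t * δ < |B ω|
    · exact Or.inl (Or.inr ⟨not_le.1 g1, g2⟩)
    have g3 : t * (1 - δ) < A ω * Y ω := by
      have := (le_abs_self _).trans (not_lt.1 g2)
      linarith
    by_cases g4 : A ω ≤ K
    · exact Or.inr (Or.inl ⟨g4, g3⟩)
    · refine Or.inr (Or.inr ⟨not_le.1 g4, ?_, g3⟩)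
      have h0 : 0 ≤ t * (1 - δ) := mul_nonneg ht0 (sub_nonneg.2 hδ.le)
      have hY0 : 0 < Y ω := pos_of_mul_pos_right (h0.trans_lt g3) hω.le
      rw [← abs_of_pos hY0]
      exact not_le.1 g1
  have hu := (measureReal_union_le (μ := P)
    ({ω | |Y ω| ≤ K ∧ t < A ω * Y ω + B ω} ∪ {ω | K < |Y ω| ∧ t * δ < |B ω|})
    ({ω | A ω ≤ K ∧ t * (1 - δ) < A ω * Y ω} ∪
          {ω | K < A ω ∧ K < Y ω ∧ t * (1 - δ) < A ω * Y ω}))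
  have hu1 := (measureReal_union_le (μ := P)
    {ω | |Y ω| ≤ K ∧ t < A ω * Y ω + B ω} {ω | K < |Y ω| ∧ t * δ < |B ω|})
  have hu2 := (measureReal_union_le (μ := P) {ω | A ω ≤ K ∧ t * (1 - δ) < A ω * Y ω}
    {ω | K < A ω ∧ K < Y ω ∧ t * (1 - δ) < A ω * Y ω})
  linarith

/-- Lower bound for the tail of `A * Y + B` in terms of a lower bound for the tail of `Y`. -/
theorem le_tail_affine (h : ConvolutionTail P A A' α) {B Y : Ω → ℝ}
    (hY : Measurable Y) (hindep : IndepFun (fun ω => (A ω, B ω)) Y P) {c l T δ K t : ℝ}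
    (hc : ∀ t, tail P (fun ω => |B ω|) t ≤ c * tail P A t) (hT : K ≤ T)
    (hl : ∀ t, T ≤ t → l * tail P A t ≤ tail P Y t) (ht : K * T ≤ t * (1 + δ))
    (hK : 0 < K) (hl0 : 0 ≤ l) :
    P.real {ω | |Y ω| ≤ K ∧ t < A ω * Y ω + B ω} +
      l * P.real {ω | A ω ≤ K ∧ t * (1 + δ) < A ω * A' ω} ≤
      tail P (fun ω => A ω * Y ω + B ω) t +
        c * tail P A (t * δ) * tail P (fun ω => |Y ω|) K := by
  have hAY : IndepFun A Y P := hindep.comp measurable_fst measurable_id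
  have hA := h.meas
  have b3 : P.real {ω | K < |Y ω| ∧ t * δ < |B ω|} ≤
      c * tail P A (t * δ) * tail P (fun ω => |Y ω|) K := by
    rw [measureReal_abs_and_abs hindep]
    exact mul_le_mul_of_nonneg_right (hc _) (tail_nonneg _ _)
  have b1 : l * P.real {ω | A ω ≤ K ∧ t * (1 + δ) < A ω * A' ω} ≤
      P.real {ω | A ω ≤ K ∧ T < Y ω ∧ t * (1 + δ) < A ω * Y ω} := by
    have h1 := measureReal_product_le h.meas h.meas' hY h.indep hAY h.pos (c := l) (C := 1)
      (k := T) (fun t ht => by rw [one_mul, h.ident.tail_eq]; exact hl t ht)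
      (measurableSet_Iic (a := K)) (t * (1 + δ))
    rw [one_mul] at h1
    refine le_trans (mul_le_mul_of_nonneg_left ?_ hl0) h1
    refine ENNReal.toReal_mono (measure_ne_top _ _) (measure_mono_ae ?_)
    filter_upwards [h.pos] with ω hω hx
    refine ⟨hx.1, ?_, hx.2⟩
    by_contra hcon
    have hx1 : A ω ≤ K := hx.1
    have hx2 : t * (1 + δ) < A ω * A' ω := hx.2
    have hT0 : 0 ≤ T := hK.le.trans hT
    have : A ω * A' ω ≤ K * T :=
      calc A ω * A' ω ≤ A ω * T := by gcongr; exact not_lt.1 hcon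
        _ ≤ K * T := by gcongr
    linarith
  -- T ≥ K separates bounded from large Y, so the two contributions add up in the lower bound.
  have hdisj : Disjoint {ω | |Y ω| ≤ K ∧ t < A ω * Y ω + B ω}
      {ω | A ω ≤ K ∧ T < Y ω ∧ t * (1 + δ) < A ω * Y ω} := by
    refine Set.disjoint_left.2 fun ω h1 h2 => ?_
    have h3 : |Y ω| ≤ K := h1.1
    have h4 : T < Y ω := h2.2.1
    have := le_abs_self (Y ω)
    linarith
  have hms : MeasurableSet {ω | A ω ≤ K ∧ T < Y ω ∧ t * (1 + δ) < A ω * Y ω} :=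
    (measurableSet_le hA measurable_const).inter ((measurableSet_lt measurable_const hY).inter
      (measurableSet_lt measurable_const (hA.mul hY)))
  have hu := measureReal_union (μ := P) hdisj hms
  have hincl : P.real ({ω | |Y ω| ≤ K ∧ t < A ω * Y ω + B ω} ∪
      {ω | A ω ≤ K ∧ T < Y ω ∧ t * (1 + δ) < A ω * Y ω}) ≤
      P.real ({ω | t < A ω * Y ω + B ω} ∪ {ω | K < |Y ω| ∧ t * δ < |B ω|}) := by
    refine measureReal_mono fun ω hx => ?_
    rcases hx with hx | hx
    · exact Or.inl hx.2
    · by_cases g : t * δ < |B ω|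
      · refine Or.inr ⟨?_, g⟩
        have h4 : T < Y ω := hx.2.1
        exact (hT.trans_lt h4).trans_le (le_abs_self _)
      · left
        have h5 : t * (1 + δ) < A ω * Y ω := hx.2.2
        have := (neg_abs_le (B ω))
        have g' := not_lt.1 g
        change t < A ω * Y ω + B ω
        linarith
  have hu2 := measureReal_union_le (μ := P) {ω | t < A ω * Y ω + B ω}
    {ω | K < |Y ω| ∧ t * δ < |B ω|}
  have e1 : P.real {ω | t < A ω * Y ω + B ω} = tail P (fun ω => A ω * Y ω + B ω) t := rfl
  linarith

/-! ### Tail asymptotics for the fixed-point equation -/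

/-- The tail of a solution of the distributional equation `Y = A Y + B`. -/
theorem tendsto_tail_fixedPoint (h : ConvolutionTail P A A' α) {B Y : Ω → ℝ} (hB : Measurable B)
    (hY : Measurable Y) (hindep : IndepFun (fun ω => (A ω, B ω)) Y P) {c C : ℝ}
    (hc : ∀ t, tail P (fun ω => |B ω|) t ≤ c * tail P A t)
    (hC : ∀ t, tail P (fun ω => |Y ω|) t ≤ C * tail P A t)
    (hfix : ∀ t, tail P (fun ω => A ω * Y ω + B ω) t = tail P Y t)
    {f : ℝ → ℝ} (hf : Measurable f) (hf0 : ∀ y, 0 ≤ f y)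
    (hlim : ∀ᵐ ω ∂P, Tendsto (fun t => tail P (fun ω' => A ω' * Y ω + B ω') t / tail P A t)
      atTop (𝓝 (f (Y ω)))) :
    Integrable (fun ω => f (Y ω)) P ∧ Tendsto (fun t => tail P Y t / tail P A t) atTop
      (𝓝 ((∫ ω, f (Y ω) ∂P) / (1 - ∫ ω, A ω ^ α ∂P))) := by
  have hCY : ∀ t, tail P Y t ≤ C * tail P A t := fun t =>
    (measureReal_mono fun ω (hω : t < Y ω) => hω.trans_le (le_abs_self _)).trans (hC t)
  have hbp := fun K (hK : 0 < K) => h.tendsto_bounded_part hB hY hindep hc hf hf0 hlim hK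
  have hcover : AECover P atTop fun K : ℝ => {ω | |Y ω| ≤ K} :=
    ⟨ae_of_all _ fun ω => eventually_ge_atTop _, fun K =>
      measurableSet_le hY.abs measurable_const⟩
  have hint : Integrable (fun ω => f (Y ω)) P := by
    -- Each truncated integral is a limit of ratios bounded by ℙ[Y > t]/F(t) ≤ C, so C bounds them
    -- all.
    refine hcover.integrable_of_integral_bounded_of_nonneg_ae C
      (fun K => ?_) (ae_of_all _ fun ω => hf0 _) ?_
    · exact (hbp (max K 1) (by positivity)).1.mono_set fun ω hω =>
        le_trans (show |Y ω| ≤ K from hω) (le_max_left _ _)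
    · filter_upwards [eventually_gt_atTop 0] with K hK
      refine le_of_tendsto' (hbp K hK).2 fun t => ?_
      rw [div_le_iff₀ (h.tail_pos t)]
      refine le_trans ?_ (hCY t)
      rw [← hfix t]
      exact measureReal_mono fun ω hω => hω.2
  refine ⟨hint, ?_⟩
  have hlimK : Tendsto (fun K : ℝ => ∫ ω in {ω | |Y ω| ≤ K}, f (Y ω) ∂P) atTop
      (𝓝 (∫ ω, f (Y ω) ∂P)) := hcover.integral_tendsto_of_countably_generated hint
  have hYK : Tendsto (fun K : ℝ => tail P (fun ω => |Y ω|) K) atTop (𝓝 0) := by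
    have := h.tendsto_tail_zero.const_mul C
    rw [mul_zero] at this
    exact squeeze_zero (fun t => tail_nonneg _ t) hC this
  have hmom := h.tendsto_truncatedMoment
  set e := ∫ ω, f (Y ω) ∂P
  set ρ := ∫ ω, A ω ^ α ∂P with hρ
  refine tendsto_of_affine_bounds (C := C) h.moment_pos.le h.moment_lt_one
    (Eventually.of_forall fun t => (div_le_iff₀ (h.tail_pos t)).2 (hCY t))
    (fun t => div_nonneg (tail_nonneg _ _) (tail_nonneg _ _)) ?_ ?_
  · intro L hL0 hL ε hε
    obtain ⟨T, hT⟩ := eventually_atTop.1 hL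
    obtain ⟨δ, hδ, hδ0, hδ1⟩ : ∃ δ : ℝ, L * ρ * (1 - δ) ^ (-α) < L * ρ + ε ∧ 0 < δ ∧ δ < 1 := by
      have h1 := (tendsto_const_mul_rpow_neg (L * ρ) α (g := fun δ => 1 - δ) (by fun_prop)
        (by simp)).eventually (gt_mem_nhds (lt_add_of_pos_right (L * ρ) hε))
      exact (h1.and (Ioo_mem_nhdsGT one_pos)).exists
    have hδ' : 0 < 1 - δ := sub_pos.2 hδ1
    -- With δ fixed, letting K → ∞ kills the B-term and the term with both factors large; what
    -- remains is e + Lρ(1 - δ)^(-α). The crude constant C only multiplies a vanishing term.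
    obtain ⟨K, hK, hK0⟩ : ∃ K : ℝ, (∫ ω in {ω | |Y ω| ≤ K}, f (Y ω) ∂P) +
        c * δ ^ (-α) * tail P (fun ω => |Y ω|) K +
        L * (truncatedMoment P A α K * (1 - δ) ^ (-α)) +
        C * (2 * (ρ - truncatedMoment P A α K) * (1 - δ) ^ (-α)) < e + ρ * L + ε ∧ 0 < K := by
      have h1 := ((hlimK.add (hYK.const_mul (c * δ ^ (-α)))).add
        ((hmom.mul_const ((1 - δ) ^ (-α))).const_mul L)).add
        ((((tendsto_const_nhds (x := ρ)).sub hmom).const_mul 2).mul_const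
          ((1 - δ) ^ (-α)) |>.const_mul C)
      refine ((h1.eventually (gt_mem_nhds ?_)).and (eventually_gt_atTop 0)).exists
      rw [sub_self]
      linarith
    have h2 := (((hbp K hK0).2.add (((h.tendsto_tail_mul hδ0).const_mul c).mul_const
      (tail P (fun ω => |Y ω|) K))).add ((h.tendsto_div_tail_comp_mul
        (h.tendsto_product_of_le hK0) hδ').const_mul L)).add
        ((h.tendsto_div_tail_comp_mul (h.tendsto_product_of_gt hK0) hδ').const_mul C)
    filter_upwards [h2.eventually (gt_mem_nhds hK), eventually_ge_atTop 0,
      eventually_ge_atTop (K * max T 0 / (1 - δ))] with t h3 ht0 ht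
    refine le_trans ?_ h3.le
    rw [← hfix t]
    have h4 := h.tail_affine_le hY hindep hc hCY hL0 (le_max_right T 0)
      (fun t ht => (div_le_iff₀ (h.tail_pos t)).1 (hT t ((le_max_left _ _).trans ht)))
      ((div_le_iff₀ hδ').1 ht) ht0 hδ1
    have hF := h.tail_pos t
    refine (div_le_div_of_nonneg_right h4 hF.le).trans (le_of_eq ?_)
    field_simp
  · intro l hl0 hl ε hε
    obtain ⟨T, hT⟩ := eventually_atTop.1 hl
    obtain ⟨δ, hδ, hδ0⟩ : ∃ δ : ℝ, l * ρ - ε < l * ρ * (1 + δ) ^ (-α) ∧ 0 < δ := by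
      have h1 := (tendsto_const_mul_rpow_neg (l * ρ) α (g := fun δ => 1 + δ) (by fun_prop)
        (by simp)).eventually (lt_mem_nhds (sub_lt_self (l * ρ) hε))
      exact (h1.and self_mem_nhdsWithin).exists
    have hδ' : 0 < 1 + δ := by linarith
    obtain ⟨K, hK, hK0⟩ : ∃ K : ℝ, e + ρ * l - ε < (∫ ω in {ω | |Y ω| ≤ K}, f (Y ω) ∂P) +
        l * (truncatedMoment P A α K * (1 + δ) ^ (-α)) -
        c * δ ^ (-α) * tail P (fun ω => |Y ω|) K ∧ 0 < K := by
      have h1 := (hlimK.add ((hmom.mul_const ((1 + δ) ^ (-α))).const_mul l)).sub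
        (hYK.const_mul (c * δ ^ (-α)))
      refine ((h1.eventually (lt_mem_nhds ?_)).and (eventually_gt_atTop 0)).exists
      linarith
    have h2 := ((hbp K hK0).2.add ((h.tendsto_div_tail_comp_mul
        (h.tendsto_product_of_le hK0) hδ').const_mul l)).sub
        (((h.tendsto_tail_mul hδ0).const_mul c).mul_const (tail P (fun ω => |Y ω|) K))
    filter_upwards [h2.eventually (lt_mem_nhds hK),
      eventually_ge_atTop (K * max T K / (1 + δ))] with t h3 ht
    refine le_trans h3.le ?_
    rw [← hfix t]
    have h4 := h.le_tail_affine hY hindep hc (le_max_right T K)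
      (fun t ht => (le_div_iff₀ (h.tail_pos t)).1 (hT t ((le_max_left _ _).trans ht)))
      ((div_le_iff₀ hδ').1 ht) hK0 hl0
    have hF := h.tail_pos t
    refine le_trans (le_of_eq ?_) (div_le_div_of_nonneg_right (sub_le_iff_le_add.2 h4) hF.le)
    field_simp

end ConvolutionTail

/-! ### Independence and shifts of i.i.d. sequences -/

section IID

variable {E : Type*} [MeasurableSpace E] {Z : ℕ → Ω → E}

/-- The σ-algebras generated by the indices in {0} and in its complement are independent. -/
theorem _root_.ProbabilityTheory.iIndepFun.indepFun_shift (hZ : ∀ n, Measurable (Z n))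
    (h : iIndepFun Z P) : IndepFun (Z 0) (fun ω n => Z (n + 1) ω) P := by
  have h1 := indep_iSup_of_disjoint (fun n => (hZ n).comap_le) h
    (Set.disjoint_singleton_left.2 (fun h0 => h0 rfl) : Disjoint ({0} : Set ℕ) {0}ᶜ)
  refine indep_of_indep_of_le_left (indep_of_indep_of_le_right h1 ?_) ?_
  · rw [MeasurableSpace.pi, MeasurableSpace.comap_iSup]
    refine iSup_le fun n => ?_
    rw [MeasurableSpace.comap_comp]
    exact le_iSup₂_of_le (n + 1) (Nat.succ_ne_zero n) le_rfl
  · exact le_iSup₂_of_le 0 rfl le_rfl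

theorem _root_.ProbabilityTheory.iIndepFun.identDistrib_shift [IsProbabilityMeasure P]
    (hZ : ∀ n, Measurable (Z n)) (h : iIndepFun Z P) (hid : ∀ n, IdentDistrib (Z n) (Z 0) P P) :
    IdentDistrib (fun ω n => Z (n + 1) ω) (fun ω n => Z n ω) P P where
  aemeasurable_fst := (measurable_pi_lambda _ fun n => hZ (n + 1)).aemeasurable
  aemeasurable_snd := (measurable_pi_lambda _ fun n => hZ n).aemeasurable
  map_eq := by
    rw [h.map_fun_eq_infinitePi_map hZ,
      (h.precomp (add_left_injective 1)).map_fun_eq_infinitePi_map fun n => hZ (n + 1)]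
    congr 1
    ext1 n
    exact (hid (n + 1)).map_eq.trans (hid n).map_eq.symm

/-- The hypotheses make the joint law a threefold product, which can be reassociated. -/
theorem _root_.ProbabilityTheory.IndepFun.prodMk_left_of_prodMk_right [IsProbabilityMeasure P]
    {E₁ E₂ E₃ : Type*} [MeasurableSpace E₁] [MeasurableSpace E₂] [MeasurableSpace E₃]
    {U : Ω → E₁} {V : Ω → E₂} {W : Ω → E₃} (hU : Measurable U) (hV : Measurable V)
    (hW : Measurable W) (h : IndepFun U (fun ω => (V ω, W ω)) P) (hVW : IndepFun V W P) :
    IndepFun (fun ω => (U ω, V ω)) W P := by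
  have := Measure.isProbabilityMeasure_map (μ := P) hU.aemeasurable
  have := Measure.isProbabilityMeasure_map (μ := P) hV.aemeasurable
  have := Measure.isProbabilityMeasure_map (μ := P) hW.aemeasurable
  have hUV : IndepFun U V P := h.comp measurable_id measurable_fst
  rw [indepFun_iff_map_prod_eq_prod_map_map (hU.prodMk hV).aemeasurable hW.aemeasurable,
    (indepFun_iff_map_prod_eq_prod_map_map hU.aemeasurable hV.aemeasurable).1 hUV]
  have h1 := (indepFun_iff_map_prod_eq_prod_map_map hU.aemeasurable
    (hV.prodMk hW).aemeasurable).1 h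
  rw [(indepFun_iff_map_prod_eq_prod_map_map hV.aemeasurable hW.aemeasurable).1 hVW] at h1
  have h2 : (fun ω => ((U ω, V ω), W ω)) =
    MeasurableEquiv.prodAssoc.symm ∘ fun ω => (U ω, (V ω, W ω)) := rfl
  rw [h2, ← Measure.map_map MeasurableEquiv.prodAssoc.symm.measurable
    (hU.prodMk (hV.prodMk hW)), h1, ← Measure.prodAssoc_prod, Measure.map_map
    MeasurableEquiv.prodAssoc.symm.measurable MeasurableEquiv.prodAssoc.measurable,
    MeasurableEquiv.symm_comp_self, Measure.map_id]

end IID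

/-! ### Forward chain and backward iterates -/

/-- The random input of the chain: an i.i.d. sequence of random vectors `(A n, B n)` and an
independent initial value `X₀`. -/
structure IsInput (P : Measure Ω) (A B : ℕ → Ω → ℝ) (X₀ : Ω → ℝ) : Prop where
  measA : ∀ n, Measurable (A n)
  measB : ∀ n, Measurable (B n)
  meas₀ : Measurable X₀
  indep : iIndepFun (fun n ω => (A n ω, B n ω)) P
  ident : ∀ n, IdentDistrib (fun ω => (A n ω, B n ω)) (fun ω => (A 0 ω, B 0 ω)) P P
  indep₀ : IndepFun X₀ (fun ω n => (A n ω, B n ω)) P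

theorem perpetuityTerm_zero (A B : ℕ → Ω → ℝ) (ω : Ω) : perpetuityTerm A B 0 ω = B 0 ω := by
  simp [perpetuityTerm]

theorem perpetuityTerm_succ (A B : ℕ → Ω → ℝ) (k : ℕ) (ω : Ω) :
    perpetuityTerm A B (k + 1) ω =
      A 0 ω * perpetuityTerm (fun n => A (n + 1)) (fun n => B (n + 1)) k ω := by
  simp only [perpetuityTerm, Finset.prod_range_succ']
  ring

theorem measurable_perpetuityTerm {A B : ℕ → Ω → ℝ} (hA : ∀ n, Measurable (A n))
    (hB : ∀ n, Measurable (B n)) (k : ℕ) : Measurable (perpetuityTerm A B k) :=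
  (hB k).mul (Finset.measurable_prod _ fun j _ => hA j)

theorem measurable_perpetuity {A B : ℕ → Ω → ℝ} (hA : ∀ n, Measurable (A n))
    (hB : ∀ n, Measurable (B n)) : Measurable (perpetuity A B) :=
  Measurable.tsum fun k => measurable_perpetuityTerm hA hB k

/-- The `n`-th backward iterate `x ∏_{j < n} A j + ∑_{k < n} (∏_{j < k} A j) * B k`. -/
def backward (A B : ℕ → Ω → ℝ) (X₀ : Ω → ℝ) (n : ℕ) (ω : Ω) : ℝ :=
  X₀ ω * ∏ j ∈ Finset.range n, A j ω + ∑ k ∈ Finset.range n, perpetuityTerm A B k ω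

theorem backward_succ (A B : ℕ → Ω → ℝ) (X₀ : Ω → ℝ) (n : ℕ) (ω : Ω) :
    backward A B X₀ (n + 1) ω =
      A 0 ω * backward (fun n => A (n + 1)) (fun n => B (n + 1)) X₀ n ω + B 0 ω := by
  simp only [backward, Finset.sum_range_succ', perpetuityTerm_succ, perpetuityTerm_zero,
    Finset.prod_range_succ', ← Finset.mul_sum]
  ring

theorem measurable_backward {A B : ℕ → Ω → ℝ} {X₀ : Ω → ℝ} (hA : ∀ n, Measurable (A n))
    (hB : ∀ n, Measurable (B n)) (hX₀ : Measurable X₀) (n : ℕ) :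
    Measurable (backward A B X₀ n) :=
  (hX₀.mul (Finset.measurable_prod _ fun j _ => hA j)).add
    (Finset.measurable_sum _ fun k _ => measurable_perpetuityTerm hA hB k)

theorem chain_succ_eq (A B : ℕ → Ω → ℝ) (X₀ : Ω → ℝ) (n : ℕ) :
    chain A B X₀ (n + 1) =
      chain (fun n => A (n + 1)) (fun n => B (n + 1)) (fun ω => A 0 ω * X₀ ω + B 0 ω) n := by
  induction n with
  | zero => rfl
  | succ n ih =>
    ext ω
    rw [chain, ih, chain]

theorem measurable_chain {A B : ℕ → Ω → ℝ} {X₀ : Ω → ℝ} (hA : ∀ n, Measurable (A n))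
    (hB : ∀ n, Measurable (B n)) (hX₀ : Measurable X₀) (n : ℕ) :
    Measurable (chain A B X₀ n) := by
  induction n with
  | zero => exact hX₀
  | succ n ih => exact ((hA n).mul ih).add (hB n)

/-- The transition operator `ν ↦ law of a * y + b` for `(a, b) ∼ μ` and `y ∼ ν` independent. -/
noncomputable def transition (μ : Measure (ℝ × ℝ)) (ν : Measure ℝ) : Measure ℝ :=
  (μ.prod ν).map fun z => z.1.1 * z.2 + z.1.2

theorem map_affine_eq_transition [IsProbabilityMeasure P] {A B Y : Ω → ℝ} (hA : Measurable A)
    (hB : Measurable B) (hY : Measurable Y) (h : IndepFun (fun ω => (A ω, B ω)) Y P) :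
    P.map (fun ω => A ω * Y ω + B ω) = transition (P.map fun ω => (A ω, B ω)) (P.map Y) := by
  have hAB : Measurable fun ω => (A ω, B ω) := hA.prodMk hB
  have := Measure.isProbabilityMeasure_map (μ := P) hAB.aemeasurable
  have := Measure.isProbabilityMeasure_map (μ := P) hY.aemeasurable
  rw [transition,
    ← (indepFun_iff_map_prod_eq_prod_map_map hAB.aemeasurable hY.aemeasurable).1 h,
    Measure.map_map (by fun_prop) (hAB.prodMk hY)]
  rfl

namespace IsInput

variable [IsProbabilityMeasure P] {A B : ℕ → Ω → ℝ} {X₀ : Ω → ℝ}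

theorem measZ (h : IsInput P A B X₀) (n : ℕ) : Measurable fun ω => (A n ω, B n ω) :=
  (h.measA n).prodMk (h.measB n)

theorem indep_shift (h : IsInput P A B X₀) :
    IndepFun (fun ω => (A 0 ω, B 0 ω)) (fun ω n => (A (n + 1) ω, B (n + 1) ω)) P :=
  h.indep.indepFun_shift h.measZ

theorem ident_shift (h : IsInput P A B X₀) :
    IdentDistrib (fun ω n => (A (n + 1) ω, B (n + 1) ω)) (fun ω n => (A n ω, B n ω)) P P :=
  h.indep.identDistrib_shift h.measZ h.ident

theorem measurable_shift (h : IsInput P A B X₀) :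
    Measurable fun ω (n : ℕ) => (A (n + 1) ω, B (n + 1) ω) :=
  measurable_pi_lambda _ fun n => h.measZ (n + 1)

theorem indep₀_prod (h : IsInput P A B X₀) : IndepFun X₀
    (fun ω => ((A 0 ω, B 0 ω), fun n : ℕ => (A (n + 1) ω, B (n + 1) ω))) P :=
  h.indep₀.comp (φ := id) (ψ := fun z : ℕ → ℝ × ℝ => (z 0, fun n => z (n + 1))) measurable_id
    ((measurable_pi_apply 0).prodMk (measurable_pi_lambda _ fun n => measurable_pi_apply (n + 1)))

theorem shift (h : IsInput P A B X₀) :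
    IsInput P (fun n => A (n + 1)) (fun n => B (n + 1)) X₀ where
  measA n := h.measA (n + 1)
  measB n := h.measB (n + 1)
  meas₀ := h.meas₀
  indep := h.indep.precomp (add_left_injective 1)
  ident n := (h.ident (n + 1)).trans (h.ident 1).symm
  indep₀ := h.indep₀_prod.comp (φ := id) measurable_id measurable_snd

/-- After one move the chain restarts from its new state, still independent of the remaining input.
-/
theorem step (h : IsInput P A B X₀) : IsInput P (fun n => A (n + 1)) (fun n => B (n + 1))
    (fun ω => A 0 ω * X₀ ω + B 0 ω) where
  measA n := h.measA (n + 1)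
  measB n := h.measB (n + 1)
  meas₀ := ((h.measA 0).mul h.meas₀).add (h.measB 0)
  indep := h.shift.indep
  ident := h.shift.ident
  indep₀ := (IndepFun.prodMk_left_of_prodMk_right h.meas₀ (h.measZ 0) h.measurable_shift
    h.indep₀_prod h.indep_shift).comp
      (φ := fun p : ℝ × (ℝ × ℝ) => p.2.1 * p.1 + p.2.2) (by fun_prop) measurable_id

theorem indep_initial (h : IsInput P A B X₀) : IndepFun (fun ω => (A 0 ω, B 0 ω)) X₀ P :=
  (h.indep₀.comp (φ := id) (ψ := fun z : ℕ → ℝ × ℝ => z 0) measurable_id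
    (measurable_pi_apply 0)).symm

theorem indep_initial_shift (h : IsInput P A B X₀) : IndepFun (fun ω => (A 0 ω, B 0 ω))
    (fun ω => (X₀ ω, fun n : ℕ => (A (n + 1) ω, B (n + 1) ω))) P := by
  have h1 : IndepFun (fun ω => (fun n : ℕ => (A (n + 1) ω, B (n + 1) ω), X₀ ω))
      (fun ω => (A 0 ω, B 0 ω)) P := by
    refine IndepFun.prodMk_left_of_prodMk_right h.measurable_shift h.meas₀ (h.measZ 0) ?_
      h.indep_initial.symm
    exact (IndepFun.prodMk_left_of_prodMk_right h.meas₀ (h.measZ 0) h.measurable_shift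
      h.indep₀_prod h.indep_shift).symm
  exact h1.symm.comp (φ := id) measurable_id measurable_swap

theorem map_shift (h : IsInput P A B X₀) :
    P.map (fun ω => (A 1 ω, B 1 ω)) = P.map (fun ω => (A 0 ω, B 0 ω)) := (h.ident 1).map_eq

/-- The first move is peeled off, so the operator is applied innermost. The induction ranges over
all inputs because the initial value changes. -/
theorem map_chain (n : ℕ) : ∀ {A B : ℕ → Ω → ℝ} {X₀ : Ω → ℝ}, IsInput P A B X₀ →
    P.map (chain A B X₀ n) = (transition (P.map fun ω => (A 0 ω, B 0 ω)))^[n] (P.map X₀) := by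
  induction n with
  | zero => intros; rfl
  | succ n ih =>
    intro A B X₀ h
    rw [chain_succ_eq, ih h.step, Function.iterate_succ_apply]
    simp only [zero_add]
    rw [h.map_shift,
      map_affine_eq_transition (h.measA 0) (h.measB 0) h.meas₀ h.indep_initial]

/-- Here the pair of index 0 acts last, so the operator is applied outermost; the iterate is
nevertheless the same as for the chain. -/
theorem map_backward (n : ℕ) : ∀ {A B : ℕ → Ω → ℝ} {X₀ : Ω → ℝ}, IsInput P A B X₀ →
    P.map (backward A B X₀ n) =
      (transition (P.map fun ω => (A 0 ω, B 0 ω)))^[n] (P.map X₀) := by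
  induction n with
  | zero =>
    intro A B X₀ _
    congr 1
    ext ω
    simp [backward]
  | succ n ih =>
    intro A B X₀ h
    rw [funext (backward_succ A B X₀ n), Function.iterate_succ_apply', ← h.map_shift]
    have h1 := ih h.shift
    simp only [zero_add] at h1
    rw [← h1, h.map_shift]
    refine map_affine_eq_transition (h.measA 0) (h.measB 0)
      (measurable_backward h.shift.measA h.shift.measB h.meas₀ n) ?_
    -- The same formula read on the coordinate space exhibits the iterate as a measurable function
    -- of X₀ and the shifted sequence.
    refine h.indep_initial_shift.comp (φ := id) (ψ := fun p : ℝ × (ℕ → ℝ × ℝ) =>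
      backward (fun n p => (p.2 n).1) (fun n p => (p.2 n).2) (fun p => p.1) n p) measurable_id ?_
    exact measurable_backward (fun n => by fun_prop) (fun n => by fun_prop) (by fun_prop) n

theorem indep_perpetuity_shift (h : IsInput P A B X₀) : IndepFun (fun ω => (A 0 ω, B 0 ω))
    (perpetuity (fun n => A (n + 1)) (fun n => B (n + 1))) P :=
  h.indep_shift.comp (φ := id) (ψ := perpetuity (fun n (z : ℕ → ℝ × ℝ) => (z n).1)
    (fun n (z : ℕ → ℝ × ℝ) => (z n).2)) measurable_id
    (measurable_perpetuity (fun n => by fun_prop) (fun n => by fun_prop))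

theorem identDistrib_perpetuity_shift (h : IsInput P A B X₀) :
    IdentDistrib (perpetuity (fun n => A (n + 1)) (fun n => B (n + 1))) (perpetuity A B) P P :=
  h.ident_shift.comp (u := perpetuity (fun n (z : ℕ → ℝ × ℝ) => (z n).1)
    (fun n (z : ℕ → ℝ × ℝ) => (z n).2))
    (measurable_perpetuity (fun n => by fun_prop) (fun n => by fun_prop))

end IsInput

/-! ### Uniform tail domination and absolute convergence -/

/-- The partial sums of the absolute values of the terms of the perpetuity. -/
def absPartialSum (A B : ℕ → Ω → ℝ) (n : ℕ) (ω : Ω) : ℝ :=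
  ∑ k ∈ Finset.range n, |perpetuityTerm A B k ω|

theorem measurable_absPartialSum {A B : ℕ → Ω → ℝ} (hA : ∀ n, Measurable (A n))
    (hB : ∀ n, Measurable (B n)) (n : ℕ) : Measurable (absPartialSum A B n) :=
  Finset.measurable_sum _ fun k _ => (measurable_perpetuityTerm hA hB k).abs

theorem absPartialSum_succ (A B : ℕ → Ω → ℝ) (n : ℕ) (ω : Ω) :
    absPartialSum A B (n + 1) ω =
      |A 0 ω| * absPartialSum (fun n => A (n + 1)) (fun n => B (n + 1)) n ω + |B 0 ω| := by
  simp only [absPartialSum, Finset.sum_range_succ', perpetuityTerm_succ, perpetuityTerm_zero,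
    abs_mul, ← Finset.mul_sum]

theorem absPartialSum_mono (A B : ℕ → Ω → ℝ) (ω : Ω) :
    Monotone fun n => absPartialSum A B n ω := fun _ _ hmn =>
  Finset.sum_le_sum_of_subset_of_nonneg (Finset.range_mono hmn) fun _ _ _ => abs_nonneg _

namespace IsInput

variable [IsProbabilityMeasure P] {A B : ℕ → Ω → ℝ} {X₀ : Ω → ℝ} {α : ℝ}

/-- The tails of the partial sums of the perpetuity are uniformly dominated by that of `A`. -/
theorem exists_tail_absPartialSum_le (h : IsInput P A B X₀)
    (hA : ConvolutionTail P (A 0) (A 1) α) {c : ℝ}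
    (hc : ∀ t, tail P (fun ω => |B 0 ω|) t ≤ c * tail P (A 0) t) :
    ∃ C, ∀ n t, tail P (absPartialSum A B n) t ≤ C * tail P (A 0) t := by
  obtain ⟨θ, D, t₁, hθ0, hθ1, hD0, hstep⟩ := hA.exists_affine_tail_bound hc
  -- Nonnegativity of t₀ makes the tail of the empty sum vanish beyond it.
  set t₀ := max t₁ 0 with ht₀
  -- The first entry makes the bound trivial for t ≤ t₀, as probabilities are at most 1; the second
  -- is the fixed point of C ↦ θC + D, so the bound reproduces itself.
  set C := max (tail P (A 0) t₀)⁻¹ (D / (1 - θ)) with hCdef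
  have hF0 := hA.tail_pos t₀
  have hC0 : 0 ≤ C := (inv_pos.2 hF0).le.trans (le_max_left _ _)
  have hCD : θ * C + D ≤ C := by
    have := (div_le_iff₀ (sub_pos.2 hθ1)).1 (le_max_right (tail P (A 0) t₀)⁻¹ (D / (1 - θ)))
    rw [← hCdef] at this
    linarith
  have hsmall : ∀ Y : Ω → ℝ, ∀ t ≤ t₀, tail P Y t ≤ C * tail P (A 0) t := fun Y t ht =>
    calc tail P Y t ≤ 1 := tail_le_one _ _
      _ = (tail P (A 0) t₀)⁻¹ * tail P (A 0) t₀ := (inv_mul_cancel₀ hF0.ne').symm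
      _ ≤ C * tail P (A 0) t :=
        mul_le_mul (le_max_left _ _) (tail_antitone _ ht) (tail_nonneg _ _) hC0
  refine ⟨C, fun n => ?_⟩
  induction n with
  | zero =>
    intro t
    rcases le_total t t₀ with ht | ht
    · exact hsmall _ t ht
    · have h0 : tail P (absPartialSum A B 0) t = 0 := by
        have h1 : {ω | t < absPartialSum A B 0 ω} = ∅ := by
          ext ω
          simpa [absPartialSum] using (le_max_right t₁ 0).trans ht
        simp [tail, h1]
      rw [h0]
      exact mul_nonneg hC0 (tail_nonneg _ _)
  | succ n ih =>
    intro t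
    rcases le_total t t₀ with ht | ht
    · exact hsmall _ t ht
    have hmS : Measurable (absPartialSum (fun n (z : ℕ → ℝ × ℝ) => (z n).1)
        (fun n (z : ℕ → ℝ × ℝ) => (z n).2) n) :=
      measurable_absPartialSum (fun n => by fun_prop) (fun n => by fun_prop) n
    have hid : IdentDistrib (absPartialSum (fun n => A (n + 1)) (fun n => B (n + 1)) n)
      (absPartialSum A B n) P P := h.ident_shift.comp hmS
    have hind : IndepFun (A 0) (absPartialSum (fun n => A (n + 1)) (fun n => B (n + 1)) n) P :=
      h.indep_shift.comp measurable_fst hmS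
    have h1 := hstep _ (measurable_absPartialSum h.shift.measA h.shift.measB n) hind C hC0
      (fun t => by rw [hid.tail_eq]; exact ih t) t ((le_max_left _ _).trans ht)
    refine le_trans (le_of_eq ?_) (h1.trans
      (mul_le_mul_of_nonneg_right hCD (tail_nonneg _ _)))
    refine measureReal_congr ?_
    filter_upwards [hA.pos] with ω hω
    refine propext ?_
    change t < _ ↔ t < _
    rw [absPartialSum_succ, abs_of_pos hω]

/-- Partial sums increase in n, so continuity from below passes the uniform bound to their supremum.
-/
theorem exists_absPartialSum_bound (h : IsInput P A B X₀)
    (hA : ConvolutionTail P (A 0) (A 1) α) {c : ℝ}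
    (hc : ∀ t, tail P (fun ω => |B 0 ω|) t ≤ c * tail P (A 0) t) :
    ∃ C, ∀ t, P.real {ω | ∃ n, t < absPartialSum A B n ω} ≤ C * tail P (A 0) t := by
  obtain ⟨C, hC⟩ := h.exists_tail_absPartialSum_le hA hc
  refine ⟨C, fun t => ?_⟩
  have h1 := tendsto_measure_iUnion_atTop (μ := P) (s := fun n => {ω | t < absPartialSum A B n ω})
    fun m n hmn ω hω => lt_of_lt_of_le hω (absPartialSum_mono A B ω hmn)
  have h2 := (ENNReal.tendsto_toReal (measure_ne_top P _)).comp h1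
  have h3 : {ω | ∃ n, t < absPartialSum A B n ω} = ⋃ n, {ω | t < absPartialSum A B n ω} := by
    ext ω
    simp
  rw [h3]
  exact le_of_tendsto' h2 fun n => hC n t

/-- Divergence means exceeding every level t, an event of probability at most C F(t) → 0. -/
theorem ae_summable_abs (h : IsInput P A B X₀)
    (hA : ConvolutionTail P (A 0) (A 1) α) {c : ℝ}
    (hc : ∀ t, tail P (fun ω => |B 0 ω|) t ≤ c * tail P (A 0) t) :
    ∀ᵐ ω ∂P, Summable fun k => |perpetuityTerm A B k ω| := by
  obtain ⟨C, hC⟩ := h.exists_absPartialSum_bound hA hc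
  have h1 : Tendsto (fun t => C * tail P (A 0) t) atTop (𝓝 0) := by
    simpa using hA.tendsto_tail_zero.const_mul C
  have h2 : P.real {ω | ∀ t : ℝ, ∃ n, t < absPartialSum A B n ω} = 0 := by
    refine le_antisymm (ge_of_tendsto' h1 fun t => ?_) measureReal_nonneg
    exact (measureReal_mono (Set.ofPred_subset_ofPred.2 fun ω hω => hω t)).trans (hC t)
  have h3 : ∀ᵐ ω ∂P, ¬ ∀ t : ℝ, ∃ n, t < absPartialSum A B n ω := by
    rw [ae_iff]
    simpa [measureReal_def, ENNReal.toReal_eq_zero_iff] using h2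
  filter_upwards [h3] with ω hω
  push Not at hω
  obtain ⟨t, ht⟩ := hω
  exact summable_of_sum_range_le (fun _ => abs_nonneg _) ht

end IsInput

namespace ConvolutionTail

variable [IsProbabilityMeasure P] {A A' : Ω → ℝ} {α : ℝ}

theorem tail_le_inv_mul (h : ConvolutionTail P A A' α) (Y : Ω → ℝ) {t t₀ : ℝ} (ht : t ≤ t₀) :
    tail P Y t ≤ (tail P A t₀)⁻¹ * tail P A t :=
  calc tail P Y t ≤ 1 := tail_le_one _ _
    _ = (tail P A t₀)⁻¹ * tail P A t₀ := (inv_mul_cancel₀ (h.tail_pos t₀).ne').symm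
    _ ≤ (tail P A t₀)⁻¹ * tail P A t :=
      mul_le_mul_of_nonneg_left (tail_antitone _ ht) (inv_nonneg.2 (tail_nonneg _ _))

/-- Beyond some t₀ the limsup gives the constant; below it F is at least F(t₀) > 0. -/
theorem exists_tail_le_of_limsup_lt_top (h : ConvolutionTail P A A' α) {Y : Ω → ℝ}
    (hY : limsup (fun t : ℝ => P {ω | t < Y ω} / P {ω | t < A ω}) atTop < ⊤) :
    ∃ c, ∀ t, tail P Y t ≤ c * tail P A t := by
  obtain ⟨b, hb, -⟩ := ENNReal.lt_iff_exists_nnreal_btwn.1 hY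
  obtain ⟨t₀, ht₀⟩ := eventually_atTop.1 (eventually_lt_of_limsup_lt hb)
  refine ⟨max b (tail P A t₀)⁻¹, fun t => ?_⟩
  rcases le_total t t₀ with ht | ht
  · exact (h.tail_le_inv_mul Y ht).trans
      (mul_le_mul_of_nonneg_right (le_max_right _ _) (tail_nonneg _ _))
  · refine le_trans ?_ (mul_le_mul_of_nonneg_right (le_max_left _ _) (tail_nonneg _ _))
    have hA0 : P {ω | t < A ω} ≠ 0 := fun h0 => by
      have := h.tail_pos t
      simp [tail, measureReal_def, h0] at this
    have h1 := (ENNReal.div_le_iff hA0 (measure_ne_top _ _)).1 (ht₀ t ht).le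
    have h2 := ENNReal.toReal_mono (by finiteness) h1
    rwa [ENNReal.toReal_mul] at h2

end ConvolutionTail

/-! ### Stationarity, weak convergence and tails of the perpetuity -/

namespace IsInput

variable [IsProbabilityMeasure P] {A B : ℕ → Ω → ℝ} {X₀ : Ω → ℝ} {α : ℝ}

/-- Replacing `B` by `max |B| 1`. -/
theorem max_abs_one (h : IsInput P A B X₀) :
    IsInput P A (fun n ω => max |B n ω| 1) X₀ where
  measA := h.measA
  measB n := (h.measB n).abs.max measurable_const
  meas₀ := h.meas₀
  indep := h.indep.comp (fun _ p => (p.1, max |p.2| 1)) fun _ => by fun_prop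
  ident n := (h.ident n).comp (u := fun p => (p.1, max |p.2| 1)) (by fun_prop)
  indep₀ := h.indep₀.comp (φ := id) (ψ := fun (z : ℕ → ℝ × ℝ) n => ((z n).1, max |(z n).2| 1))
    measurable_id (by fun_prop)

theorem exists_tail_max_abs_one_le (hA : ConvolutionTail P (A 0) (A 1) α) {c : ℝ}
    (hc : ∀ t, tail P (fun ω => |B 0 ω|) t ≤ c * tail P (A 0) t) :
    ∃ c', ∀ t, tail P (fun ω => |max |B 0 ω| 1|) t ≤ c' * tail P (A 0) t := by
  refine ⟨max c (tail P (A 0) 1)⁻¹, fun t => ?_⟩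
  rcases le_total t 1 with ht | ht
  · exact (hA.tail_le_inv_mul _ ht).trans
      (mul_le_mul_of_nonneg_right (le_max_right _ _) (tail_nonneg _ _))
  · refine le_trans ?_ ((hc t).trans
      (mul_le_mul_of_nonneg_right (le_max_left _ _) (tail_nonneg _ _)))
    refine measureReal_mono fun ω hω => ?_
    have h1 : t < |max |B 0 ω| 1| := hω
    rw [abs_of_pos (lt_max_of_lt_right one_pos)] at h1
    exact (lt_max_iff.1 h1).resolve_right (not_lt.2 ht)

/-- With B replaced by max(|B|, 1) the series still converges absolutely, and its terms dominate the
products. -/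
theorem ae_tendsto_prod_zero (h : IsInput P A B X₀) (hA : ConvolutionTail P (A 0) (A 1) α) {c : ℝ}
    (hc : ∀ t, tail P (fun ω => |B 0 ω|) t ≤ c * tail P (A 0) t) :
    ∀ᵐ ω ∂P, Tendsto (fun n => ∏ j ∈ Finset.range n, A j ω) atTop (𝓝 0) := by
  obtain ⟨c', hc'⟩ := exists_tail_max_abs_one_le hA hc
  filter_upwards [h.max_abs_one.ae_summable_abs hA hc'] with ω hω
  refine squeeze_zero_norm (fun n => ?_) hω.tendsto_atTop_zero
  simp only [perpetuityTerm, abs_mul, Real.norm_eq_abs]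
  refine le_mul_of_one_le_left (abs_nonneg _) ?_
  exact (le_max_right _ _).trans (le_abs_self _)

/-- The perpetuity solves the fixed point equation pathwise. -/
theorem perpetuity_ae_eq (hs : ∀ᵐ ω ∂P, Summable fun k => perpetuityTerm A B k ω) :
    perpetuity A B =ᵐ[P] fun ω =>
      A 0 ω * perpetuity (fun n => A (n + 1)) (fun n => B (n + 1)) ω + B 0 ω := by
  filter_upwards [hs] with ω hω
  rw [perpetuity, hω.tsum_eq_zero_add, perpetuityTerm_zero, add_comm]
  simp only [perpetuityTerm_succ, tsum_mul_left]
  rfl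

theorem map_perpetuity (h : IsInput P A B X₀)
    (hs : ∀ᵐ ω ∂P, Summable fun k => perpetuityTerm A B k ω) :
    P.map (perpetuity A B) =
      transition (P.map fun ω => (A 0 ω, B 0 ω)) (P.map (perpetuity A B)) := by
  conv_lhs => rw [Measure.map_congr (perpetuity_ae_eq hs)]
  rw [map_affine_eq_transition (h.measA 0) (h.measB 0)
    (measurable_perpetuity h.shift.measA h.shift.measB) h.indep_perpetuity_shift,
    h.identDistrib_perpetuity_shift.map_eq]

/-- Weak convergence of the chain to the perpetuity. -/
theorem tendstoInDistribution_chain (h : IsInput P A B X₀)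
    (hs : ∀ᵐ ω ∂P, Summable fun k => perpetuityTerm A B k ω)
    (hprod : ∀ᵐ ω ∂P, Tendsto (fun n => ∏ j ∈ Finset.range n, A j ω) atTop (𝓝 0)) :
    TendstoInDistribution (chain A B X₀) atTop (perpetuity A B) (fun _ => P) P := by
  have h1 : TendstoInDistribution (backward A B X₀) atTop (perpetuity A B) (fun _ => P) P := by
    refine tendstoInDistribution_of_ae_tendsto
      (fun n => (measurable_backward h.measA h.measB h.meas₀ n).aemeasurable)
      (measurable_perpetuity h.measA h.measB).aemeasurable ?_
    filter_upwards [hs, hprod] with ω h1 h2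
    have h3 := (h2.const_mul (X₀ ω)).add h1.hasSum.tendsto_sum_nat
    rw [mul_zero, zero_add] at h3
    exact h3
  -- Convergence in distribution sees only the laws, which agree for chain and backward iterate at
  -- each n.
  refine ⟨fun n => (measurable_chain h.measA h.measB h.meas₀ n).aemeasurable,
    h1.aemeasurable_limit, h1.tendsto.congr fun n => Subtype.ext ?_⟩
  exact (map_backward n h).trans (map_chain n h).symm

theorem tail_abs_perpetuity_le {C t : ℝ}
    (hC : P.real {ω | ∃ n, t < absPartialSum A B n ω} ≤ C) :
    tail P (fun ω => |perpetuity A B ω|) t ≤ C := by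
  refine (measureReal_mono fun ω hω => ?_).trans hC
  by_contra hcon
  have hle : ∀ n, absPartialSum A B n ω ≤ t := fun n => not_lt.1 fun hlt => hcon ⟨n, hlt⟩
  have hsum : Summable fun k => |perpetuityTerm A B k ω| :=
    summable_of_sum_range_le (fun _ => abs_nonneg _) hle
  have h1 : |perpetuity A B ω| ≤ ∑' k, |perpetuityTerm A B k ω| := by
    have := norm_tsum_le_tsum_norm (f := fun k => perpetuityTerm A B k ω) hsum
    exact this
  have h2 : ∑' k, |perpetuityTerm A B k ω| ≤ t :=
    Real.tsum_le_of_sum_range_le (fun _ => abs_nonneg _) hle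
  exact absurd hω (not_lt.2 (h1.trans h2))

/-- The right tail of the perpetuity. -/
theorem tendsto_tail_perpetuity (h : IsInput P A B X₀)
    (hA : ConvolutionTail P (A 0) (A 1) α) {c : ℝ}
    (hc : ∀ t, tail P (fun ω => |B 0 ω|) t ≤ c * tail P (A 0) t)
    {f : ℝ → ℝ} (hf : Measurable f) (hf0 : ∀ y, 0 ≤ f y)
    (hlim : ∀ y ∈ (P.map (perpetuity A B)).support,
      Tendsto (fun t => tail P (fun ω => A 0 ω * y + B 0 ω) t / tail P (A 0) t) atTop
        (𝓝 (f y))) :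
    Integrable (fun ω => f (perpetuity A B ω)) P ∧
      Tendsto (fun t => tail P (perpetuity A B) t / tail P (A 0) t) atTop
        (𝓝 ((∫ ω, f (perpetuity A B ω) ∂P) / (1 - ∫ ω, A 0 ω ^ α ∂P))) := by
  obtain ⟨C, hC⟩ := h.exists_absPartialSum_bound hA hc
  have hs : ∀ᵐ ω ∂P, Summable fun k => perpetuityTerm A B k ω :=
    (h.ae_summable_abs hA hc).mono fun ω hω => hω.of_abs
  have hid := h.identDistrib_perpetuity_shift
  have hYm := measurable_perpetuity h.shift.measA h.shift.measB
  -- This copy of X, independent of (A 0, B 0), realises the fixed-point equation almost surely.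
  set Y := perpetuity (fun n => A (n + 1)) (fun n => B (n + 1)) with hYdef
  have habs : IdentDistrib (fun ω => |Y ω|) (fun ω => |perpetuity A B ω|) P P :=
    hid.comp (u := fun x => |x|) (by fun_prop)
  have hfY : IdentDistrib (fun ω => f (Y ω)) (fun ω => f (perpetuity A B ω)) P P := hid.comp hf
  -- The limits are assumed only on the support, which carries full mass.
  have hsupp : ∀ᵐ ω ∂P, Y ω ∈ (P.map (perpetuity A B)).support := by
    have h1 : ∀ᵐ y ∂(P.map Y), y ∈ (P.map (perpetuity A B)).support := by
      rw [hid.map_eq]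
      exact Measure.support_mem_ae
    exact ae_of_ae_map hYm.aemeasurable h1
  have key := hA.tendsto_tail_fixedPoint (h.measB 0) hYm h.indep_perpetuity_shift hc (C := C)
    (fun t => by rw [habs.tail_eq]; exact tail_abs_perpetuity_le (hC t))
    (fun t => by
      rw [hid.tail_eq]
      refine measureReal_congr ?_
      filter_upwards [perpetuity_ae_eq hs] with ω hω
      refine propext ?_
      change t < _ ↔ t < _
      rw [hω]) hf hf0 (hsupp.mono fun ω hω => hlim _ hω)
  refine ⟨hfY.integrable_iff.1 key.1, ?_⟩
  rw [← hfY.integral_eq]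
  refine key.2.congr fun t => ?_
  rw [hid.tail_eq]

/-- Flipping the sign of B turns X into -X and so reduces the left tail to the right one. -/
theorem neg (h : IsInput P A B X₀) : IsInput P A (fun n ω => -B n ω) X₀ where
  measA := h.measA
  measB n := (h.measB n).neg
  meas₀ := h.meas₀
  indep := h.indep.comp (fun _ p => (p.1, -p.2)) fun _ => by fun_prop
  ident n := (h.ident n).comp (u := fun p => (p.1, -p.2)) (by fun_prop)
  indep₀ := h.indep₀.comp (φ := id) (ψ := fun (z : ℕ → ℝ × ℝ) n => ((z n).1, -(z n).2))
    measurable_id (by fun_prop)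

theorem perpetuity_neg (A B : ℕ → Ω → ℝ) :
    perpetuity A (fun n ω => -B n ω) = fun ω => -perpetuity A B ω := by
  ext ω
  simp only [perpetuity, perpetuityTerm, neg_mul, tsum_neg]

theorem leftTail_eq (Y : Ω → ℝ) (t : ℝ) : leftTail P Y t = tail P (fun ω => -Y ω) t := by
  unfold leftTail tail
  congr 1
  ext ω
  change Y ω < -t ↔ t < -Y ω
  exact lt_neg

/-- The left tail of the perpetuity. -/
theorem tendsto_leftTail_perpetuity (h : IsInput P A B X₀)
    (hA : ConvolutionTail P (A 0) (A 1) α) {c : ℝ}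
    (hc : ∀ t, tail P (fun ω => |B 0 ω|) t ≤ c * tail P (A 0) t)
    {f : ℝ → ℝ} (hf : Measurable f) (hf0 : ∀ y, 0 ≤ f y)
    (hlim : ∀ y ∈ (P.map (perpetuity A B)).support,
      Tendsto (fun t => leftTail P (fun ω => A 0 ω * y + B 0 ω) t / tail P (A 0) t) atTop
        (𝓝 (f y))) :
    Integrable (fun ω => f (perpetuity A B ω)) P ∧
      Tendsto (fun t => leftTail P (perpetuity A B) t / tail P (A 0) t) atTop
        (𝓝 ((∫ ω, f (perpetuity A B ω) ∂P) / (1 - ∫ ω, A 0 ω ^ α ∂P))) := by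
  have hX := measurable_perpetuity h.measA h.measB
  have h1 := h.neg.tendsto_tail_perpetuity hA (c := c) (by simpa using hc)
    (f := fun y => f (-y)) (hf.comp measurable_neg) (fun y => hf0 _) ?_
  · simpa only [perpetuity_neg, neg_neg, leftTail_eq] using h1
  · intro y hy
    -- The support of the law of -X is the reflection of that of X, so the limit is available at -y.
    have hy' : -y ∈ (P.map (perpetuity A B)).support := by
      rw [perpetuity_neg] at hy
      rw [Measure.mem_support_iff_forall] at hy ⊢
      intro U hU
      have h2 := hy (Neg.neg ⁻¹' U) (continuous_neg.continuousAt.preimage_mem_nhds hU)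
      have h3 : P.map (fun ω => -perpetuity A B ω) =
          (P.map (perpetuity A B)).map (MeasurableEquiv.neg ℝ) := by
        rw [Measure.map_map (MeasurableEquiv.neg ℝ).measurable hX]
        rfl
      rw [h3, MeasurableEquiv.map_apply] at h2
      have h4 : (MeasurableEquiv.neg ℝ) ⁻¹' (Neg.neg ⁻¹' U) = U := by
        ext x
        simp
      rwa [h4] at h2
    refine (hlim _ hy').congr fun t => ?_
    rw [leftTail_eq]
    congr 2
    ext ω
    ring

end IsInput

end RandomDifference

theorem mainTheorem2 {Ω : Type*} [MeasurableSpace Ω] (P : Measure Ω) [IsProbabilityMeasure P]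
    -- an i.i.d. sequence of random vectors `(A n, B n)`, with generic element `(A 0, B 0)`
    (A B : ℕ → Ω → ℝ) (hA : ∀ n, Measurable (A n)) (hB : ∀ n, Measurable (B n))
    (hindep : iIndepFun (fun n ω => (A n ω, B n ω)) P)
    (hident : ∀ n, IdentDistrib (fun ω => (A n ω, B n ω)) (fun ω => (A 0 ω, B 0 ω)) P P)
    (hpos : ∀ᵐ ω ∂P, 0 < A 0 ω)
    -- the initial value of the chain, independent of the sequence
    (X₀ : Ω → ℝ) (hX₀ : Measurable X₀)
    (hX₀indep : IndepFun X₀ (fun ω n => (A n ω, B n ω)) P)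
    -- regular variation, the convolution condition and the moment condition
    (α : ℝ) (hα : 0 < α)
    (hreg : ∀ y : ℝ, 0 < y → RandomDifference.TailEquiv
      (fun t => RandomDifference.tail P (A 0) (t * y))
      (fun t => y ^ (-α) * RandomDifference.tail P (A 0) t))
    (hint : Integrable (fun ω => A 0 ω ^ α) P)
    (hconv : RandomDifference.TailEquiv
      (fun t => RandomDifference.tail P (fun ω => A 0 ω * A 1 ω) t)
      (fun t => 2 * (∫ ω, A 0 ω ^ α ∂P) * RandomDifference.tail P (A 0) t))
    (hmom : ∫ ω, A 0 ω ^ α ∂P < 1)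
    -- the tail of `|B|` is at most of the order of that of `A`
    (htailB : limsup (fun t : ℝ => P {ω | t < |B 0 ω|} / P {ω | t < A 0 ω}) atTop < ⊤)
    -- the tails of `A y + B` for `y` in the support of the law of the perpetuity
    (fplus fminus : ℝ → ℝ) (hfp : Measurable fplus) (hfm : Measurable fminus)
    (hfp0 : ∀ y, 0 ≤ fplus y) (hfm0 : ∀ y, 0 ≤ fminus y)
    (hplus : ∀ y ∈ (P.map (RandomDifference.perpetuity A B)).support,
      Tendsto (fun t => RandomDifference.tail P (fun ω => A 0 ω * y + B 0 ω) t /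
        RandomDifference.tail P (A 0) t) atTop (𝓝 (fplus y)))
    (hminus : ∀ y ∈ (P.map (RandomDifference.perpetuity A B)).support,
      Tendsto (fun t => RandomDifference.leftTail P (fun ω => A 0 ω * y + B 0 ω) t /
        RandomDifference.tail P (A 0) t) atTop (𝓝 (fminus y))) :
    -- the perpetuity converges and its law solves `X = A X + B` in distribution,
    -- with `X` independent of `(A, B)`
    (∀ᵐ ω ∂P, Summable (fun k => RandomDifference.perpetuityTerm A B k ω)) ∧
    IdentDistrib (RandomDifference.perpetuity A B)
      (fun z : (ℝ × ℝ) × ℝ => z.1.1 * z.2 + z.1.2) P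
      ((P.map (fun ω => (A 0 ω, B 0 ω))).prod (P.map (RandomDifference.perpetuity A B))) ∧
    -- weak convergence of the chain
    TendstoInDistribution (RandomDifference.chain A B X₀) atTop
      (RandomDifference.perpetuity A B) (fun _ => P) P ∧
    -- the right tail
    Integrable (fun ω => fplus (RandomDifference.perpetuity A B ω)) P ∧
    Tendsto (fun t => RandomDifference.tail P (RandomDifference.perpetuity A B) t /
        RandomDifference.tail P (A 0) t) atTop
      (𝓝 ((∫ ω, fplus (RandomDifference.perpetuity A B ω) ∂P) / (1 - ∫ ω, A 0 ω ^ α ∂P))) ∧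
    -- the left tail
    Integrable (fun ω => fminus (RandomDifference.perpetuity A B ω)) P ∧
    Tendsto (fun t => RandomDifference.leftTail P (RandomDifference.perpetuity A B) t /
        RandomDifference.tail P (A 0) t) atTop
      (𝓝 ((∫ ω, fminus (RandomDifference.perpetuity A B ω) ∂P) /
        (1 - ∫ ω, A 0 ω ^ α ∂P))) := by
  have h : RandomDifference.IsInput P A B X₀ := ⟨hA, hB, hX₀, hindep, hident, hX₀indep⟩
  have hid : IdentDistrib (A 1) (A 0) P P := (hident 1).comp measurable_fst
  have hind : IndepFun (A 0) (A 1) P :=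
    (hindep.indepFun zero_ne_one).comp measurable_fst measurable_fst
  have hT : RandomDifference.ConvolutionTail P (A 0) (A 1) α :=
    ⟨hA 0, hA 1, hind, hid, hpos, hα, hreg, hint, hconv, hmom⟩
  obtain ⟨c, hc⟩ := hT.exists_tail_le_of_limsup_lt_top htailB
  have hs : ∀ᵐ ω ∂P, Summable fun k => RandomDifference.perpetuityTerm A B k ω :=
    (h.ae_summable_abs hT hc).mono fun ω hω => hω.of_abs
  have hX := RandomDifference.measurable_perpetuity hA hB
  obtain ⟨hp1, hp2⟩ := h.tendsto_tail_perpetuity hT hc hfp hfp0 hplus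
  obtain ⟨hm1, hm2⟩ := h.tendsto_leftTail_perpetuity hT hc hfm hfm0 hminus
  exact ⟨hs, ⟨hX.aemeasurable, by fun_prop, h.map_perpetuity hs⟩,
    h.tendstoInDistribution_chain hs (h.ae_tendsto_prod_zero hT hc), hp1, hp2, hm1, hm2⟩
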